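/- Let $1<q<\infty$. Let $C^\infty_{0,\sigma}(\mathbb R^3)$ be the space of all smooth compactly supported vector fields $\varphi:\mathbb R^3\to\mathbb R^3$ with $\operatorname{div}\varphi=0$, and let $L^q_\sigma(\mathbb R^3)$ be its closure in $L^q(\mathbb R^3)=L^q(\mathbb R^3;\mathbb R^3)$. Let $$Z_q(\mathbb R^3)=\{u\in L^q_\sigma(\mathbb R^3)\cap W^{1,q}(\mathbb R^3):\ |x|\nabla u\in L^q(\mathbb R^3)\},$$ where $\nabla u$ is the weak gradient (a $3\times 3$-matrix-valued function, its size being measured by the operator norm), endowed with the norm $$\|u\|_{Z_q(\mathbb R^3)}=\|u\|_{L^q(\mathbb R^3)}+\|\nabla u\|_{L^q(\mathbb R^3)}+\big\||x|\nabla u\big\|_{L^q(\mathbb R^3)}.$$ Then $C^\infty_{0,\sigma}(\mathbb R^3)$ is contained in $Z_q(\mathbb R^3)$ and is dense in $Z_q(\mathbb R^3)$ with respect to the norm $\|\cdot\|_{Z_q(\mathbb R^3)}$. -/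

import Mathlib

open MeasureTheory
open scoped ENNReal ContDiff

noncomputable section

/-- Three-dimensional Euclidean space. -/
abbrev R3 : Type := EuclideanSpace ℝ (Fin 3)

/-- The classical divergence `∑ i, ∂ᵢ φᵢ` of a vector field. -/
def divergence (φ : R3 → R3) (x : R3) : ℝ :=
  ∑ i : Fin 3, fderiv ℝ φ x (EuclideanSpace.single i 1) i

/-- The space of smooth, compactly supported, solenoidal (divergence free) vector fields. -/
def SolenoidalTest : Submodule ℝ (R3 → R3) where
  carrier := {φ | ContDiff ℝ ∞ φ ∧ HasCompactSupport φ ∧ ∀ x, divergence φ x = 0}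
  zero_mem' := by
    refine ⟨contDiff_const, HasCompactSupport.zero, fun x => ?_⟩
    simp [divergence]
  add_mem' := by
    rintro φ ψ ⟨h1, h2, h3⟩ ⟨k1, k2, k3⟩
    refine ⟨h1.add k1, h2.add k2, fun x => ?_⟩
    have e := fderiv_add (h1.differentiable (by simp) x) (k1.differentiable (by simp) x)
    have h := h3 x
    have k := k3 x
    simp only [divergence] at h k ⊢
    simp [e, Finset.sum_add_distrib, h, k]
  smul_mem' := by
    rintro c φ ⟨h1, h2, h3⟩
    refine ⟨contDiff_const.smul h1, h2.smul_left (f := fun _ => c), fun x => ?_⟩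
    have e := fderiv_const_smul (h1.differentiable (by simp) x) c
    have h := h3 x
    simp only [divergence] at h ⊢
    simp [e, ← Finset.mul_sum, h]

/-- `G` is the weak gradient of `u`: both are locally integrable, and for every scalar test
function `φ` and every direction `v` one has `∫ φ (G v) = - ∫ (∂ᵥ φ) u`. -/
def IsWeakGradient (u : R3 → R3) (G : R3 → R3 →L[ℝ] R3) : Prop :=
  LocallyIntegrable u ∧ LocallyIntegrable G ∧
    ∀ φ : R3 → ℝ, ContDiff ℝ ∞ φ → HasCompactSupport φ → ∀ v : R3,
      ∫ x, φ x • G x v = - ∫ x, fderiv ℝ φ x v • u x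

lemma IsWeakGradient.congr {u u' : R3 → R3} {G G' : R3 → R3 →L[ℝ] R3}
    (h : IsWeakGradient u G) (hu : u =ᵐ[volume] u') (hG : G =ᵐ[volume] G') :
    IsWeakGradient u' G' := by
  refine ⟨?_, ?_, fun φ h1 h2 v => ?_⟩
  · exact fun x => (h.1 x).congr hu
  · exact fun x => (h.2.1 x).congr hG
  · have e1 : ∫ x, φ x • G' x v = ∫ x, φ x • G x v :=
      integral_congr_ae (by filter_upwards [hG] with x hx; rw [hx])
    have e2 : ∫ x, fderiv ℝ φ x v • u' x = ∫ x, fderiv ℝ φ x v • u x :=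
      integral_congr_ae (by filter_upwards [hu] with x hx; rw [hx])
    rw [e1, e2]
    exact h.2.2 φ h1 h2 v

lemma LocallyIntegrable.apply_vec {G : R3 → R3 →L[ℝ] R3} (h : LocallyIntegrable G) (v : R3) :
    LocallyIntegrable (fun x => G x v) := by
  intro x
  obtain ⟨s, hs, hi⟩ := h x
  exact ⟨s, hs, hi.apply_continuousLinearMap v⟩

lemma LocallyIntegrable.add_of_normed {E : Type*} [NormedAddCommGroup E] {f g : R3 → E}
    (hf : LocallyIntegrable f) (hg : LocallyIntegrable g) : LocallyIntegrable (f + g) :=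
  hf.add hg

lemma MemLp.add_of_normed {E : Type*} [NormedAddCommGroup E] {f g : R3 → E} {q : ℝ≥0∞}
    (hf : MemLp f q volume) (hg : MemLp g q volume) : MemLp (f + g) q volume :=
  hf.add hg

lemma fderiv_test_continuous {φ : R3 → ℝ} (h1 : ContDiff ℝ ∞ φ) (v : R3) :
    Continuous (fun x => fderiv ℝ φ x v) :=
  (h1.continuous_fderiv (by simp)).clm_apply continuous_const

lemma fderiv_test_support {φ : R3 → ℝ} (h2 : HasCompactSupport φ) (v : R3) :
    HasCompactSupport (fun x => fderiv ℝ φ x v) :=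
  (h2.fderiv ℝ).comp_left (g := fun L : R3 →L[ℝ] ℝ => L v) (by simp)

lemma IsWeakGradient.add {u w : R3 → R3} {G H : R3 → R3 →L[ℝ] R3}
    (h : IsWeakGradient u G) (k : IsWeakGradient w H) : IsWeakGradient (u + w) (G + H) := by
  refine ⟨LocallyIntegrable.add_of_normed h.1 k.1, LocallyIntegrable.add_of_normed h.2.1 k.2.1,
    fun φ h1 h2 v => ?_⟩
  have i1 := (LocallyIntegrable.apply_vec h.2.1 v).integrable_smul_left_of_hasCompactSupport
    h1.continuous h2
  have i2 := (LocallyIntegrable.apply_vec k.2.1 v).integrable_smul_left_of_hasCompactSupport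
    h1.continuous h2
  have i3 := h.1.integrable_smul_left_of_hasCompactSupport
    (fderiv_test_continuous h1 v) (fderiv_test_support h2 v)
  have i4 := k.1.integrable_smul_left_of_hasCompactSupport
    (fderiv_test_continuous h1 v) (fderiv_test_support h2 v)
  simp only [Pi.add_apply, _root_.add_apply, smul_add]
  rw [integral_add i1 i2, integral_add i3 i4, h.2.2 φ h1 h2 v, k.2.2 φ h1 h2 v, neg_add]

lemma IsWeakGradient.const_smul {u : R3 → R3} {G : R3 → R3 →L[ℝ] R3}
    (h : IsWeakGradient u G) (c : ℝ) : IsWeakGradient (c • u) (c • G) := by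
  refine ⟨h.1.smul c, h.2.1.smul c, fun φ h1 h2 v => ?_⟩
  simp only [Pi.smul_apply, _root_.smul_apply, smul_comm _ c]
  rw [integral_smul, integral_smul, h.2.2 φ h1 h2 v, smul_neg]

/-- Weak gradients are unique up to null sets. -/
lemma IsWeakGradient.unique {u : R3 → R3} {G H : R3 → R3 →L[ℝ] R3}
    (h : IsWeakGradient u G) (k : IsWeakGradient u H) : G =ᵐ[volume] H := by
  have key : ∀ i : Fin 3, ∀ᵐ x, G x (EuclideanSpace.single i 1) =
      H x (EuclideanSpace.single i 1) := by
    intro i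
    refine ae_eq_of_integral_contDiff_smul_eq
      (LocallyIntegrable.apply_vec h.2.1 _) (LocallyIntegrable.apply_vec k.2.1 _) ?_
    intro φ h1 h2
    rw [h.2.2 φ h1 h2, k.2.2 φ h1 h2]
  filter_upwards [ae_all_iff.2 key] with x hx
  have : (G x : R3 →ₗ[ℝ] R3) = H x :=
    (EuclideanSpace.basisFun (Fin 3) ℝ).toBasis.ext (fun i => by simpa using hx i)
  exact ContinuousLinearMap.coe_injective this

/-- The vector fields in `L^q` having a representative that is smooth, compactly supported and
solenoidal. -/
def solenoidalTestLp (q : ℝ≥0∞) [Fact (1 ≤ q)] : Submodule ℝ (Lp R3 q (volume : Measure R3)) where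
  carrier := {u | ∃ φ ∈ SolenoidalTest, u =ᵐ[volume] φ}
  zero_mem' := ⟨0, SolenoidalTest.zero_mem, Lp.coeFn_zero _ _ _⟩
  add_mem' := by
    rintro u w ⟨φ, h, h'⟩ ⟨ψ, k, k'⟩
    exact ⟨φ + ψ, SolenoidalTest.add_mem h k, (Lp.coeFn_add u w).trans (h'.add k')⟩
  smul_mem' := by
    rintro c u ⟨φ, h, h'⟩
    exact ⟨c • φ, SolenoidalTest.smul_mem c h, (Lp.coeFn_smul c u).trans (h'.const_smul c)⟩

/-- `L^q_σ`: the closure in `L^q` of the smooth compactly supported solenoidal vector fields. -/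
def LqSigma (q : ℝ≥0∞) [Fact (1 ≤ q)] : Submodule ℝ (Lp R3 q (volume : Measure R3)) :=
  (solenoidalTestLp q).topologicalClosure

/-- The linear space `{u ∈ L^q_σ ∩ W^{1,q} : |x| ∇u ∈ L^q}`. -/
def ZqSubmodule (q : ℝ≥0∞) [Fact (1 ≤ q)] : Submodule ℝ (Lp R3 q (volume : Measure R3)) where
  carrier := {u | u ∈ LqSigma q ∧ ∃ G : Lp (R3 →L[ℝ] R3) q (volume : Measure R3),
    IsWeakGradient u G ∧ MemLp (fun x => ‖x‖ • G x) q volume}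
  zero_mem' := by
    refine ⟨(LqSigma q).zero_mem, 0, ?_, ?_⟩
    · have h0 : IsWeakGradient 0 0 :=
        ⟨locallyIntegrable_const (0 : R3), locallyIntegrable_const (0 : R3 →L[ℝ] R3), by simp⟩
      exact h0.congr (Lp.coeFn_zero _ _ _).symm (Lp.coeFn_zero _ _ _).symm
    · refine (MemLp.zero (ε := R3 →L[ℝ] R3)).ae_eq ?_
      filter_upwards [Lp.coeFn_zero (R3 →L[ℝ] R3) q (volume : Measure R3)] with x hx
      simp
  add_mem' := by
    rintro u w ⟨hu, G, h, h'⟩ ⟨hw, H, k, k'⟩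
    refine ⟨(LqSigma q).add_mem hu hw, G + H,
      (h.add k).congr (Lp.coeFn_add u w).symm (Lp.coeFn_add G H).symm, (MemLp.add_of_normed h' k').ae_eq ?_⟩
    filter_upwards [Lp.coeFn_add G H] with x hx
    rw [hx, Pi.add_apply, Pi.add_apply, smul_add]
  smul_mem' := by
    rintro c u ⟨hu, G, h, h'⟩
    refine ⟨(LqSigma q).smul_mem c hu, c • G,
      (h.const_smul c).congr (Lp.coeFn_smul c u).symm (Lp.coeFn_smul c G).symm,
      (h'.const_smul c).ae_eq ?_⟩
    filter_upwards [Lp.coeFn_smul c G] with x hx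
    rw [hx, Pi.smul_apply, Pi.smul_apply, smul_comm]

/-- The space `Z_q`, a type of its own because it carries its own norm (below), not the one
induced from `L^q`. -/
def Zq (q : ℝ≥0∞) [Fact (1 ≤ q)] : Type := ZqSubmodule q

namespace Zq

variable {q : ℝ≥0∞} [Fact (1 ≤ q)]

instance : AddCommGroup (Zq q) := inferInstanceAs (AddCommGroup (ZqSubmodule q))

instance : Module ℝ (Zq q) := inferInstanceAs (Module ℝ (ZqSubmodule q))

/-- The inclusion of `Z_q` into `L^q`. -/
def toLq : Zq q →ₗ[ℝ] Lp R3 q (volume : Measure R3) := (ZqSubmodule q).subtype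

lemma toLq_injective : Function.Injective (toLq : Zq q → _) := Subtype.val_injective

/-- The weak gradient `∇u`, as an element of `L^q`. -/
def grad (u : Zq q) : Lp (R3 →L[ℝ] R3) q (volume : Measure R3) := u.2.2.choose

lemma isWeakGradient_grad (u : Zq q) : IsWeakGradient (toLq u) (grad u) :=
  u.2.2.choose_spec.1

lemma memLp_weight_grad (u : Zq q) : MemLp (fun x => ‖x‖ • grad u x) q volume :=
  u.2.2.choose_spec.2

/-- The weighted gradient `|x| ∇u`, as an element of `L^q`. -/
def wgrad (u : Zq q) : Lp (R3 →L[ℝ] R3) q (volume : Measure R3) := (memLp_weight_grad u).toLp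

lemma coeFn_wgrad (u : Zq q) : wgrad u =ᵐ[volume] fun x => ‖x‖ • grad u x :=
  (memLp_weight_grad u).coeFn_toLp

lemma grad_add (u w : Zq q) : grad (u + w) = grad u + grad w := by
  refine Lp.ext ((isWeakGradient_grad (u + w)).unique ?_)
  refine ((isWeakGradient_grad u).add (isWeakGradient_grad w)).congr ?_ (Lp.coeFn_add _ _).symm
  rw [map_add]
  exact (Lp.coeFn_add _ _).symm

lemma grad_smul (c : ℝ) (u : Zq q) : grad (c • u) = c • grad u := by
  refine Lp.ext ((isWeakGradient_grad (c • u)).unique ?_)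
  refine ((isWeakGradient_grad u).const_smul c).congr ?_ (Lp.coeFn_smul _ _).symm
  rw [map_smul]
  exact (Lp.coeFn_smul _ _).symm

lemma wgrad_add (u w : Zq q) : wgrad (u + w) = wgrad u + wgrad w := by
  refine Lp.ext ?_
  filter_upwards [coeFn_wgrad (u + w), coeFn_wgrad u, coeFn_wgrad w,
    Lp.coeFn_add (wgrad u) (wgrad w), Lp.coeFn_add (grad u) (grad w)] with x h1 h2 h3 h4 h5
  rw [h1, h4, grad_add, h5, Pi.add_apply, Pi.add_apply, h2, h3, smul_add]

lemma wgrad_smul (c : ℝ) (u : Zq q) : wgrad (c • u) = c • wgrad u := by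
  refine Lp.ext ?_
  filter_upwards [coeFn_wgrad (c • u), coeFn_wgrad u,
    Lp.coeFn_smul c (wgrad u), Lp.coeFn_smul c (grad u)] with x h1 h2 h4 h5
  rw [h1, h4, grad_smul, h5, Pi.smul_apply, Pi.smul_apply, h2, smul_comm]

/-- The norm `‖u‖_q + ‖∇u‖_q + ‖|x| ∇u‖_q` of `Z_q`. -/
def zNorm : AddGroupNorm (Zq q) where
  toFun u := ‖toLq u‖ + ‖grad u‖ + ‖wgrad u‖
  map_zero' := by
    have h1 : grad (0 : Zq q) = 0 := by simpa using grad_smul 0 (0 : Zq q)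
    have h2 : wgrad (0 : Zq q) = 0 := by simpa using wgrad_smul 0 (0 : Zq q)
    simp [h1, h2]
  add_le' u w := by
    rw [map_add, grad_add, wgrad_add]
    linarith [norm_add_le (toLq u) (toLq w), norm_add_le (grad u) (grad w),
      norm_add_le (wgrad u) (wgrad w)]
  neg' u := by
    have h1 : grad (-u) = -grad u := by simpa using grad_smul (-1) u
    have h2 : wgrad (-u) = -wgrad u := by simpa using wgrad_smul (-1) u
    rw [map_neg, h1, h2, norm_neg, norm_neg, norm_neg]
  eq_zero_of_map_eq_zero' u h := by
    have h1 : ‖toLq u‖ = 0 := by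
      linarith [norm_nonneg (toLq u), norm_nonneg (grad u), norm_nonneg (wgrad u)]
    exact toLq_injective (by rw [norm_eq_zero.1 h1, map_zero])

instance : NormedAddCommGroup (Zq q) := zNorm.toNormedAddCommGroup

lemma norm_def (u : Zq q) : ‖u‖ = ‖toLq u‖ + ‖grad u‖ + ‖wgrad u‖ := rfl

instance : NormedSpace ℝ (Zq q) where
  norm_smul_le c u := by
    rw [norm_def, norm_def, map_smul, grad_smul, wgrad_smul, norm_smul, norm_smul, norm_smul]
    linarith

end Zq

end

noncomputable section

/-! ### Affine perturbations of the identity -/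

/-! Mollification by translations alone does not obviously control the weight `|x|`, so `u` is
averaged over all affine maps close to the identity. For a smooth weight `w` supported near `0` put
`A u (x) = ∫ w(N, b) (1 + N)⁻¹ u(x + N x + b) d(N, b)`. The factor `(1 + N)⁻¹` makes each pull-back
preserve solenoidal fields: its gradient is the conjugate `(1 + N)⁻¹ ∇u (1 + N)`, which has the same
trace up to the change of point. Hence `A` maps test fields to test fields
(`IsParamWeight.affOp_mem_solenoidalTest`).

Two facts then give density. First, `A u` and the averaged gradient tend to `u` and `∇u`, the latter
also with the weight `|x|`, as `w` concentrates at the origin (`exists_paramWeight`): the affine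
maps act continuously on `L^q`, and change `|x|` only by a small multiple of `1 + |x|`.

Second, for fixed `w`, the norm of `A v` in `Z_q` is bounded by the `L^q` norm of `v` alone
(`IsParamWeight.exists_gradOp_le`). Integration by parts in `b` moves the gradient to the kernel.
The factor `|x|` is absorbed because `x + N x + b` is unchanged when `(N, b)` moves along `(B, -B
x)`: if `B x = |x| e`, then `|x|` times the `b`-derivative of the kernel along `e` has the same
integral as its `N`-derivative along `B`, and `B` can be chosen with norm at most one
(`weighted_affOp_le`).

So fix `w` with `A u` close to `u`, then take a test field `φ` close to `u` merely in `L^q`. The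
test field `A φ` is close to `A u`, hence to `u`, in `Z_q`. -/

/-- Parameters `(N, b)` of the affine maps `x ↦ x + N x + b`. -/
abbrev AffParam : Type := (R3 →L[ℝ] R3) × R3

/-- A Haar measure on the space of parameters. -/
def affMeasure : Measure AffParam := (Measure.addHaar : Measure (R3 →L[ℝ] R3)).prod volume

instance : affMeasure.IsAddHaarMeasure := by unfold affMeasure; infer_instance

/-- The affine map with parameter `p`. -/
def affAct (p : AffParam) (x : R3) : R3 := x + p.1 x + p.2

lemma contDiff_affAct {n : ℕ∞ω} : ContDiff ℝ n (fun z : R3 × AffParam => affAct z.2 z.1) := by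
  unfold affAct
  exact (contDiff_fst.add ((contDiff_fst.comp contDiff_snd).clm_apply contDiff_fst)).add
    (contDiff_snd.comp contDiff_snd)

lemma continuous_affAct : Continuous (fun z : R3 × AffParam => affAct z.2 z.1) :=
  (contDiff_affAct (n := 0)).continuous

lemma continuous_affAct_left (p : AffParam) : Continuous (affAct p) :=
  continuous_affAct.comp (Continuous.prodMk continuous_id continuous_const)

lemma continuous_affAct_param (x : R3) : Continuous (fun p => affAct p x) :=
  continuous_affAct.comp (Continuous.prodMk continuous_const continuous_id)

lemma hasFDerivAt_affAct (p : AffParam) (x : R3) : HasFDerivAt (affAct p) (1 + p.1) x :=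
  ((hasFDerivAt_id x).add p.1.hasFDerivAt).add_const p.2

lemma norm_fst_apply_le (p : AffParam) (x : R3) : ‖p.1 x‖ ≤ ‖p‖ * ‖x‖ :=
  (p.1.le_opNorm x).trans (by gcongr; exact norm_fst_le p)

lemma norm_affAct_sub_le (p : AffParam) (x : R3) : ‖affAct p x - x‖ ≤ ‖p‖ * (‖x‖ + 1) := by
  have e : affAct p x - x = p.1 x + p.2 := by unfold affAct; abel
  rw [e]
  calc ‖p.1 x + p.2‖ ≤ ‖p.1 x‖ + ‖p.2‖ := norm_add_le _ _
    _ ≤ ‖p‖ * ‖x‖ + ‖p‖ := add_le_add (norm_fst_apply_le p x) (norm_snd_le p)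
    _ = _ := by ring

/-- The displacement is at most `(‖x‖ + 1) / 2`, which is absorbed on the left. This confines
supports and compares the weights at `x` and at its image. -/
lemma norm_le_affAct {p : AffParam} (hp : ‖p‖ ≤ 1 / 2) (x : R3) :
    ‖x‖ ≤ 2 * ‖affAct p x‖ + 1 := by
  have h1 := norm_affAct_sub_le p x
  have h2 : ‖x‖ ≤ ‖affAct p x‖ + ‖affAct p x - x‖ := by
    have := norm_sub_le (affAct p x) (affAct p x - x)
    simpa using this
  nlinarith [norm_nonneg x]

/-! ### Uniform changes of variables and continuity in `L^q` -/

lemma exists_radius : ∃ r : ℝ, 0 < r ∧ r ≤ 1 / 2 ∧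
    ∀ N : R3 →L[ℝ] R3, ‖N‖ ≤ r → 1 / 2 ≤ |(1 + N).det| := by
  have hc : ContinuousAt (fun N : R3 →L[ℝ] R3 => |(1 + N).det|) 0 :=
    (continuous_abs.comp (ContinuousLinearMap.continuous_det.comp
      (continuous_const.add continuous_id))).continuousAt
  have h1 : |(1 + (0 : R3 →L[ℝ] R3)).det| = 1 := by
    rw [add_zero, ContinuousLinearMap.one_def, ContinuousLinearMap.det]
    simp
  have := hc.eventually (lt_mem_nhds (a := (1 / 2 : ℝ)) (by dsimp only; rw [h1]; norm_num))
  obtain ⟨ε, hε, h⟩ := Metric.eventually_nhds_iff.1 this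
  refine ⟨min (ε / 2) (1 / 2), by positivity, min_le_right _ _, fun N hN => (h ?_).le⟩
  rw [dist_zero_right]
  exact hN.trans_lt ((min_le_left _ _).trans_lt (by linarith))

/-- A radius such that all affine maps with smaller parameters are uniformly invertible. -/
def affRadius : ℝ := exists_radius.choose

lemma affRadius_pos : 0 < affRadius := exists_radius.choose_spec.1

lemma affRadius_le : affRadius ≤ 1 / 2 := exists_radius.choose_spec.2.1

lemma half_le_abs_det {p : AffParam} (hp : ‖p‖ ≤ affRadius) : 1 / 2 ≤ |(1 + p.1).det| :=
  exists_radius.choose_spec.2.2 _ ((norm_fst_le p).trans hp)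

/-- Translation preserves the volume and `1 + N` scales it by `|det|⁻¹`, at most `2` by the choice
of `affRadius`. -/
lemma map_affAct_le {p : AffParam} (hp : ‖p‖ ≤ affRadius) :
    (volume : Measure R3).map (affAct p) ≤ (2 : ℝ≥0∞) • volume := by
  have hd := half_le_abs_det hp
  have hd0 : (1 + p.1).det ≠ 0 := by
    intro h
    rw [h] at hd
    norm_num at hd
  have e : affAct p = (fun y => y + p.2) ∘ (1 + p.1 : R3 →L[ℝ] R3) := by
    ext1 x
    simp [affAct]
  rw [e, ← Measure.map_map (measurable_add_const _) (1 + p.1 : R3 →L[ℝ] R3).measurable,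
    ← ContinuousLinearMap.coe_coe (1 + p.1),
    Measure.map_linearMap_addHaar_eq_smul_addHaar _ hd0, Measure.map_smul,
    map_add_right_eq_self]
  refine Measure.le_iff.2 fun s _ => ?_
  simp only [Measure.smul_apply, smul_eq_mul]
  gcongr
  change ENNReal.ofReal |((1 + p.1).det)⁻¹| ≤ 2
  rw [abs_inv]
  refine ENNReal.ofReal_le_of_le_toReal ?_
  rw [ENNReal.toReal_ofNat]
  rw [inv_le_comm₀ (by linarith) (by norm_num)]
  linarith

lemma quasiMeasurePreserving_affAct {p : AffParam} (hp : ‖p‖ ≤ affRadius) :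
    Measure.QuasiMeasurePreserving (affAct p) volume volume :=
  ⟨(continuous_affAct_left p).measurable,
    (Measure.absolutelyContinuous_of_le (map_affAct_le hp)).trans
      (Measure.smul_absolutelyContinuous)⟩

lemma eLpNorm_comp_affAct_le {E : Type*} [NormedAddCommGroup E] {p : AffParam} (hp : ‖p‖ ≤ affRadius) {q : ℝ≥0∞} (hq : 1 ≤ q)
    {f : R3 → E} (hf : AEStronglyMeasurable f volume) :
    eLpNorm (fun x => f (affAct p x)) q volume ≤ 2 * eLpNorm f q volume := by
  have h1 : eLpNorm f q ((volume : Measure R3).map (affAct p)) =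
      eLpNorm (fun x => f (affAct p x)) q volume :=
    eLpNorm_map_measure (hf.mono_ac (quasiMeasurePreserving_affAct hp).absolutelyContinuous)
      (continuous_affAct_left p).aemeasurable
  rw [← h1]
  refine (eLpNorm_mono_measure f (map_affAct_le hp)).trans ?_
  rw [eLpNorm_smul_measure_of_ne_zero (by norm_num)]
  simp only [smul_eq_mul]
  gcongr
  -- The natural constant is `2 ^ (1 / q)`; since `1 / q ≤ 1` it is replaced by `2`.
  refine (ENNReal.rpow_le_rpow_of_exponent_le (y := (1 / q).toReal) (z := 1) (by norm_num) ?_).trans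
    (by simp)
  have : (1 / q) ≤ 1 := by rw [one_div]; exact ENNReal.inv_le_one.2 hq
  exact ENNReal.toReal_le_of_le_ofReal zero_le_one (by simpa using this)

/-- Jensen's inequality and Tonelli's theorem: averaging does not increase `L^q` norms. -/
lemma eLpNorm_lintegral_le {α β : Type*} [MeasurableSpace α] [MeasurableSpace β]
    (μ : Measure α) [SFinite μ] (ν : Measure β) [IsProbabilityMeasure ν] {q : ℝ≥0∞} (hq : 1 ≤ q)
    (hq' : q ≠ ⊤) {g : α × β → ℝ≥0∞} (hg : Measurable g) {c : ℝ≥0∞}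
    (h : ∀ᵐ y ∂ν, eLpNorm (fun x => g (x, y)) q μ ≤ c) :
    eLpNorm (fun x => ∫⁻ y, g (x, y) ∂ν) q μ ≤ c := by
  have hq0 : q ≠ 0 := (zero_lt_one.trans_le hq).ne'
  have hr : 0 < q.toReal := ENNReal.toReal_pos hq0 hq'
  have key : ∀ x, (∫⁻ y, g (x, y) ∂ν) ^ q.toReal ≤ ∫⁻ y, g (x, y) ^ q.toReal ∂ν := by
    intro x
    -- Jensen's inequality in the form of monotonicity of `L^p` norms on a probability space.
    have h1 := eLpNorm_le_eLpNorm_of_exponent_le (μ := ν) (f := fun y => g (x, y)) hq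
      (hg.comp measurable_prodMk_left).aestronglyMeasurable
    rw [eLpNorm_one_eq_lintegral_enorm, eLpNorm_eq_lintegral_rpow_enorm_toReal hq0 hq'] at h1
    simp only [enorm_eq_self] at h1
    calc _ ≤ _ := ENNReal.rpow_le_rpow h1 hr.le
      _ = _ := by rw [← ENNReal.rpow_mul, one_div_mul_cancel hr.ne', ENNReal.rpow_one]
  rw [eLpNorm_eq_lintegral_rpow_enorm_toReal hq0 hq']
  simp only [enorm_eq_self]
  rw [one_div, ENNReal.rpow_inv_le_iff hr]
  calc ∫⁻ x, (∫⁻ y, g (x, y) ∂ν) ^ q.toReal ∂μ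
      ≤ ∫⁻ x, ∫⁻ y, g (x, y) ^ q.toReal ∂ν ∂μ := lintegral_mono key
    _ = ∫⁻ y, ∫⁻ x, g (x, y) ^ q.toReal ∂μ ∂ν :=
      lintegral_lintegral_swap (hg.pow_const _).aemeasurable
    _ ≤ ∫⁻ y, c ^ q.toReal ∂ν := by
      refine lintegral_mono_ae ?_
      filter_upwards [h] with y hy
      rw [eLpNorm_eq_lintegral_rpow_enorm_toReal hq0 hq', one_div,
        ENNReal.rpow_inv_le_iff hr] at hy
      simpa only [enorm_eq_self] using hy
    _ = c ^ q.toReal := by simp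

/-- As for translations: the action is uniformly bounded on `L^q`, and on continuous compactly
supported functions, which are dense, uniform continuity gives the convergence. -/
lemma eLpNorm_comp_affAct_sub_le {E : Type*} [NormedAddCommGroup E] [NormedSpace ℝ E]
    {q : ℝ≥0∞} (hq : 1 ≤ q) (hq' : q ≠ ⊤) {f : R3 → E}
    (hf : MemLp f q volume) {ε : ℝ≥0∞} (hε : ε ≠ 0) :
    ∃ δ > 0, ∀ p : AffParam, ‖p‖ ≤ δ →
      eLpNorm (fun x => f (affAct p x) - f x) q volume ≤ ε := by
  have hε4 : ε / 4 ≠ 0 := by simp [hε]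
  obtain ⟨g, hgc, hfg, hg, hgq⟩ := hf.exists_hasCompactSupport_eLpNorm_sub_le hq' hε4
  obtain ⟨R, hR0, hR⟩ : ∃ R : ℝ, 0 < R ∧ ∀ x, R < ‖x‖ → g x = 0 := by
    obtain ⟨R, hR⟩ := hgc.isCompact.isBounded.subset_closedBall (0 : R3)
    refine ⟨max R 1, by positivity, fun x hx => ?_⟩
    by_contra h
    have := hR (subset_tsupport g h)
    rw [mem_closedBall_zero_iff] at this
    exact absurd (hx.trans_le this) (not_lt.2 (le_max_left _ _))
  -- Outside the ball of radius `S`, both `x` and its image lie outside the ball of radius `R`, by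
  -- `norm_le_affAct`.
  set S : ℝ := 2 * R + 1
  set V : ℝ≥0∞ := volume (Metric.closedBall (0 : R3) S) ^ (1 / q.toReal)
  have hV : V ≠ ⊤ :=
    ENNReal.rpow_ne_top_of_nonneg (by positivity) (measure_closedBall_lt_top).ne
  obtain ⟨η, hη0, hη⟩ : ∃ η : ℝ, 0 < η ∧ ENNReal.ofReal η * V ≤ ε / 4 := by
    obtain ⟨η, hη, h⟩ := ENNReal.exists_nnreal_pos_mul_lt hV hε4
    exact ⟨η, by exact_mod_cast hη, by simpa using h.le⟩
  obtain ⟨d, hd0, hd⟩ := Metric.uniformContinuous_iff.1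
    (hgc.uniformContinuous_of_continuous hg) η hη0
  -- On the ball of radius `S` the displacement `‖p‖ * (‖x‖ + 1)` is then at most `d / 2`.
  refine ⟨min affRadius (d / (2 * (S + 1))), lt_min affRadius_pos (by positivity),
    fun p hp => ?_⟩
  have hp1 : ‖p‖ ≤ affRadius := hp.trans (min_le_left _ _)
  have hp2 : ‖p‖ ≤ d / (2 * (S + 1)) := hp.trans (min_le_right _ _)
  have hgg : eLpNorm (fun x => g (affAct p x) - g x) q volume ≤ ε / 4 := by
    have hb : ∀ x, ‖g (affAct p x) - g x‖ ≤
        (Metric.closedBall (0 : R3) S).indicator (fun _ => η) x := by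
      intro x
      by_cases hx : x ∈ Metric.closedBall (0 : R3) S
      · rw [Set.indicator_of_mem hx]
        rw [mem_closedBall_zero_iff] at hx
        rw [← dist_eq_norm]
        refine (hd ?_).le
        rw [dist_eq_norm]
        refine (norm_affAct_sub_le p x).trans_lt ?_
        calc ‖p‖ * (‖x‖ + 1) ≤ d / (2 * (S + 1)) * (S + 1) := by gcongr
          _ = d / 2 := by
            have : S + 1 ≠ 0 := by positivity
            field_simp
          _ < d := by linarith
      · rw [Set.indicator_of_notMem hx]
        rw [mem_closedBall_zero_iff, not_le] at hx
        have := norm_le_affAct (hp1.trans affRadius_le) x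
        rw [hR x (by simp only [S] at hx; linarith),
          hR (affAct p x) (by simp only [S] at hx; linarith)]
        simp
    refine (eLpNorm_mono_real hb).trans ?_
    rw [eLpNorm_indicator_const Metric.isClosed_closedBall.measurableSet
      (zero_lt_one.trans_le hq).ne' hq', Real.enorm_eq_ofReal hη0.le]
    exact hη
  have hm : AEStronglyMeasurable (fun x => f (affAct p x)) volume :=
    hf.1.comp_quasiMeasurePreserving (quasiMeasurePreserving_affAct hp1)
  have hgm : AEStronglyMeasurable (fun x => g (affAct p x)) volume :=
    (hg.comp (continuous_affAct_left p)).aestronglyMeasurable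
  have e : (fun x => f (affAct p x) - f x) =
      (fun x => (f - g) (affAct p x)) + ((fun x => g (affAct p x) - g x) - (f - g)) := by
    ext1 x
    simp only [Pi.add_apply, Pi.sub_apply]
    abel
  rw [e]
  refine (eLpNorm_add_le (hm.sub hgm) ((hgm.sub hgq.1).sub (hf.1.sub hgq.1)) hq).trans ?_
  refine (add_le_add (eLpNorm_comp_affAct_le hp1 hq (hf.1.sub hgq.1))
    ((eLpNorm_sub_le (hgm.sub hgq.1) (hf.1.sub hgq.1) hq).trans (add_le_add hgg hfg))).trans ?_
  calc 2 * eLpNorm (f - g) q volume + (ε / 4 + ε / 4) ≤ 2 * (ε / 4) + (ε / 4 + ε / 4) := by gcongr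
    _ = 4 * (ε / 4) := by ring
    _ = ε := ENNReal.mul_div_cancel (by norm_num) (by norm_num)

/-! ### Integral operators along affine maps -/

/-- The admissible parameters. -/
def paramBall : Set AffParam := Metric.closedBall 0 affRadius

lemma isCompact_paramBall : IsCompact paramBall := isCompact_closedBall _ _

lemma norm_le_of_mem_paramBall {p : AffParam} (hp : p ∈ paramBall) : ‖p‖ ≤ affRadius :=
  mem_closedBall_zero_iff.1 hp

lemma norm_le_half_of_mem_paramBall {p : AffParam} (hp : p ∈ paramBall) : ‖p‖ ≤ 1 / 2 :=
  (norm_le_of_mem_paramBall hp).trans affRadius_le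

/-- The integral of `|f|` over all images of `x` under admissible affine maps. -/
def affAvg {E : Type*} [NormedAddCommGroup E] (f : R3 → E) (x : R3) : ℝ≥0∞ :=
  ∫⁻ p in paramBall, ‖f (affAct p x)‖ₑ ∂affMeasure

/-- The total mass of the admissible parameters. -/
def paramMass : ℝ≥0∞ := affMeasure paramBall

lemma paramMass_ne_top : paramMass ≠ ⊤ := isCompact_paramBall.measure_lt_top.ne

lemma paramMass_ne_zero : paramMass ≠ 0 :=
  (Metric.measure_closedBall_pos affMeasure _ affRadius_pos).ne'

lemma eLpNorm_affAvg_le {E : Type*} [NormedAddCommGroup E] [NormedSpace ℝ E]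
    {q : ℝ≥0∞} (hq : 1 ≤ q) (hq' : q ≠ ⊤) {f : R3 → E} (hf : StronglyMeasurable f) :
    eLpNorm (affAvg f) q volume ≤ 2 * paramMass * eLpNorm f q volume := by
  set ν : Measure AffParam := paramMass⁻¹ • affMeasure.restrict paramBall
  have hν : IsProbabilityMeasure ν := by
    refine ⟨?_⟩
    simp only [ν, Measure.smul_apply, Measure.restrict_apply_univ, smul_eq_mul]
    exact ENNReal.inv_mul_cancel paramMass_ne_zero paramMass_ne_top
  -- The total mass is moved into the function, so that the average is over a probability measure.
  set g : R3 → E := fun x => paramMass.toReal • f x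
  have hg : StronglyMeasurable g := hf.const_smul _
  have hge : ∀ y, ‖g y‖ₑ = paramMass * ‖f y‖ₑ := by
    intro y
    simp only [g, enorm_smul]
    rw [Real.enorm_eq_ofReal ENNReal.toReal_nonneg, ENNReal.ofReal_toReal paramMass_ne_top]
  have e : affAvg f = fun x => ∫⁻ p, ‖g (affAct p x)‖ₑ ∂ν := by
    ext1 x
    simp only [ν, affAvg, lintegral_smul_measure, smul_eq_mul, hge]
    rw [lintegral_const_mul' _ _ paramMass_ne_top, ← mul_assoc,
      ENNReal.inv_mul_cancel paramMass_ne_zero paramMass_ne_top, one_mul]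
  rw [e]
  refine eLpNorm_lintegral_le volume ν hq hq'
    (g := fun z : R3 × AffParam => ‖g (affAct z.2 z.1)‖ₑ)
    (hg.comp_measurable continuous_affAct.measurable).enorm ?_
  refine Measure.ae_smul_measure ?_ _
  filter_upwards [ae_restrict_mem Metric.isClosed_closedBall.measurableSet] with p hp
  rw [eLpNorm_enorm]
  refine (eLpNorm_comp_affAct_le (norm_le_of_mem_paramBall hp) hq hg.aestronglyMeasurable).trans ?_
  refine (mul_le_mul_right (eLpNorm_const_smul_le (c := paramMass.toReal) (f := f)) 2).trans ?_
  rw [Real.enorm_eq_ofReal ENNReal.toReal_nonneg, ENNReal.ofReal_toReal paramMass_ne_top,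
    mul_assoc]

/-- At almost every `x` all kernel integrals converge absolutely, so the operators below can be
handled pointwise. -/
lemma ae_affAvg_lt_top {E : Type*} [NormedAddCommGroup E] [NormedSpace ℝ E]
    {q : ℝ≥0∞} (hq : 1 ≤ q) (hq' : q ≠ ⊤) {f : R3 → E} (hf : StronglyMeasurable f)
    (hfq : MemLp f q volume) : ∀ᵐ x, affAvg f x < ⊤ := by
  have hq0 : q ≠ 0 := (zero_lt_one.trans_le hq).ne'
  have hr : 0 < q.toReal := ENNReal.toReal_pos hq0 hq'
  have hm : Measurable (affAvg f) :=
    Measurable.lintegral_prod_right' (f := fun z : R3 × AffParam => ‖f (affAct z.2 z.1)‖ₑ)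
      (hf.comp_measurable continuous_affAct.measurable).enorm
  have h1 : eLpNorm (affAvg f) q volume < ⊤ :=
    (eLpNorm_affAvg_le hq hq' hf).trans_lt
      (ENNReal.mul_lt_top (ENNReal.mul_lt_top (by norm_num) paramMass_ne_top.lt_top) hfq.2)
  have h2 := (eLpNorm_lt_top_iff_lintegral_rpow_enorm_lt_top hq0 hq').1 h1
  simp only [enorm_eq_self] at h2
  filter_upwards [ae_lt_top (hm.pow_const _) h2.ne] with x hx
  exact (ENNReal.rpow_lt_top_iff_of_pos hr).1 hx

/-- The integral operator `f ↦ ∫ K(p) f(x + N x + b) dp`. -/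
def affOp {E F : Type*} [NormedAddCommGroup E] [NormedSpace ℝ E]
    [NormedAddCommGroup F] [NormedSpace ℝ F] (K : AffParam → E →L[ℝ] F) (f : R3 → E) (x : R3) : F :=
  ∫ p, K p (f (affAct p x)) ∂affMeasure

lemma exists_norm_le_of_eq_zero_off {F : Type*} [NormedAddCommGroup F] {K : AffParam → F} (hK : Continuous K)
    (hK0 : ∀ p ∉ paramBall, K p = 0) : ∃ C : ℝ, 0 ≤ C ∧ ∀ p, ‖K p‖ ≤ C := by
  obtain ⟨C, hC⟩ := isCompact_paramBall.exists_bound_of_continuousOn hK.continuousOn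
  refine ⟨max C 0, le_max_right _ _, fun p => ?_⟩
  by_cases hp : p ∈ paramBall
  · exact (hC p hp).trans (le_max_left _ _)
  · simp [hK0 p hp]

section affOp

variable {E F : Type*} [NormedAddCommGroup E] [NormedSpace ℝ E]
  [NormedAddCommGroup F] [NormedSpace ℝ F]

lemma fderiv_eq_zero_off {K : AffParam → F} (hK0 : ∀ p ∉ paramBall, K p = 0) :
    ∀ p ∉ paramBall, fderiv ℝ K p = 0 := by
  intro p hp
  have : K =ᶠ[nhds p] fun _ => 0 := by
    filter_upwards [isCompact_paramBall.isClosed.isOpen_compl.mem_nhds hp] with y hy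
    exact hK0 y hy
  rw [this.fderiv_eq]
  simp

lemma enorm_kernel_le {K : AffParam → E →L[ℝ] F} (hK0 : ∀ p ∉ paramBall, K p = 0) {C : ℝ}
    (hC : ∀ p, ‖K p‖ ≤ C) (f : R3 → E) (x : R3) (p : AffParam) :
    ‖K p (f (affAct p x))‖ₑ ≤
      paramBall.indicator (fun p => ENNReal.ofReal C * ‖f (affAct p x)‖ₑ) p := by
  by_cases hp : p ∈ paramBall
  · rw [Set.indicator_of_mem hp, ← ofReal_norm, ← ofReal_norm,
      ← ENNReal.ofReal_mul ((norm_nonneg _).trans (hC p))]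
    exact ENNReal.ofReal_le_ofReal ((K p).le_of_opNorm_le (hC p) _)
  · simp [hK0 p hp]

lemma lintegral_kernel_le {K : AffParam → E →L[ℝ] F} (hK0 : ∀ p ∉ paramBall, K p = 0) {C : ℝ}
    (hC : ∀ p, ‖K p‖ ≤ C) (f : R3 → E) (x : R3) :
    ∫⁻ p, ‖K p (f (affAct p x))‖ₑ ∂affMeasure ≤ ENNReal.ofReal C * affAvg f x := by
  refine (lintegral_mono (enorm_kernel_le hK0 hC f x)).trans ?_
  rw [lintegral_indicator isCompact_paramBall.isClosed.measurableSet,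
    lintegral_const_mul' _ _ ENNReal.ofReal_ne_top]
  rfl

lemma enorm_affOp_le {K : AffParam → E →L[ℝ] F} (hK0 : ∀ p ∉ paramBall, K p = 0) {C : ℝ}
    (hC : ∀ p, ‖K p‖ ≤ C) (f : R3 → E) (x : R3) :
    ‖affOp K f x‖ₑ ≤ ENNReal.ofReal C * affAvg f x :=
  (enorm_integral_le_lintegral_enorm _).trans (lintegral_kernel_le hK0 hC f x)

lemma integrable_kernel {K : AffParam → E →L[ℝ] F} (hK : Continuous K)
    (hK0 : ∀ p ∉ paramBall, K p = 0) {f : R3 → E} (hf : StronglyMeasurable f) {x : R3}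
    (hx : affAvg f x < ⊤) : Integrable (fun p => K p (f (affAct p x))) affMeasure := by
  obtain ⟨C, hC0, hC⟩ := exists_norm_le_of_eq_zero_off hK hK0
  refine ⟨?_, (lintegral_kernel_le hK0 hC f x).trans_lt
    (ENNReal.mul_lt_top ENNReal.ofReal_lt_top hx)⟩
  exact isBoundedBilinearMap_apply.continuous.comp_aestronglyMeasurable
    (hK.aestronglyMeasurable.prodMk
      (hf.comp_measurable (continuous_affAct_param x).measurable).aestronglyMeasurable)

lemma stronglyMeasurable_affOp {K : AffParam → E →L[ℝ] F} (hK : Continuous K) {f : R3 → E}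
    (hf : StronglyMeasurable f) : StronglyMeasurable (affOp K f) := by
  refine StronglyMeasurable.integral_prod_right'
    (f := fun z : R3 × AffParam => K z.2 (f (affAct z.2 z.1))) ?_
  exact isBoundedBilinearMap_apply.continuous.comp_stronglyMeasurable
    ((hK.stronglyMeasurable.comp_measurable measurable_snd).prodMk
      (hf.comp_measurable continuous_affAct.measurable))

lemma affOp_sub {K : AffParam → E →L[ℝ] F} (hK : Continuous K)
    (hK0 : ∀ p ∉ paramBall, K p = 0) {f g : R3 → E} (hf : StronglyMeasurable f)
    (hg : StronglyMeasurable g) {x : R3} (hfx : affAvg f x < ⊤) (hgx : affAvg g x < ⊤) :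
    affOp K (f - g) x = affOp K f x - affOp K g x := by
  unfold affOp
  rw [← integral_sub (integrable_kernel hK hK0 hf hfx) (integrable_kernel hK hK0 hg hgx)]
  simp

/-- Moving the parameter along `(B, -B x)` does not move the image of `x`, so the kernel may be
integrated by parts in this direction without any regularity of `f`. -/
lemma affOp_fderiv_invariant {Q : AffParam → E →L[ℝ] F} (hQ : ContDiff ℝ 1 Q)
    (hQ0 : ∀ p ∉ paramBall, Q p = 0) {f : R3 → E} (hf : StronglyMeasurable f) {x : R3}
    (hx : affAvg f x < ⊤) (B : R3 →L[ℝ] R3) :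
    affOp (fun p => fderiv ℝ Q p (B, -B x)) f x = 0 := by
  have h := integral_bilinear_hasLineDerivAt_right_eq_neg_left_of_integrable
    (μ := affMeasure) (B := ContinuousLinearMap.id ℝ (E →L[ℝ] F)) (f := Q)
    (f' := fun p => fderiv ℝ Q p (B, -B x)) (g := fun p => f (affAct p x)) (g' := fun _ => 0)
    (v := (B, -B x)) ?_ ?_ ?_ ?_ ?_
  · simpa [affOp] using h
  · exact integrable_kernel ((hQ.continuous_fderiv (by simp)).clm_apply continuous_const)
      (fun p hp => by rw [fderiv_eq_zero_off hQ0 p hp]; rfl) hf hx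
  · simp
  · exact integrable_kernel hQ.continuous hQ0 hf hx
  · exact fun p _ => ((hQ.differentiable (by simp)) p).hasFDerivAt.hasLineDerivAt _
  · intro p _
    -- The increments `t B x` and `-t B x` cancel, so the line derivative of `f` along the orbit is
    -- zero although `f` is only measurable.
    have : (fun t : ℝ => f (affAct (p + t • (B, -B x)) x)) = fun _ => f (affAct p x) := by
      ext1 t
      congr 1
      simp only [affAct, Prod.fst_add, Prod.snd_add, Prod.smul_fst, Prod.smul_snd, _root_.add_apply,
        _root_.smul_apply, smul_neg]
      abel
    rw [HasLineDerivAt, this]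
    exact hasDerivAt_const _ _

/-- A kernel which is a derivative in the translation parameter gains one power of `|x|`. -/
lemma weighted_affOp_le {Q : AffParam → E →L[ℝ] F} (hQ : ContDiff ℝ 1 Q)
    (hQ0 : ∀ p ∉ paramBall, Q p = 0) {C : ℝ} (hC : ∀ p, ‖fderiv ℝ Q p‖ ≤ C)
    {f : R3 → E} (hf : StronglyMeasurable f) {x : R3}
    (hx : affAvg f x < ⊤) {e : R3} (he : ‖e‖ ≤ 1) :
    ‖‖x‖ • affOp (fun p => fderiv ℝ Q p (0, e)) f x‖ₑ ≤ ENNReal.ofReal C * affAvg f x := by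
  -- Rank-one map sending `x` to `‖x‖ • e` with norm at most `1`; for `x = 0` the convention `0⁻¹ =
  -- 0` makes it zero.
  set B : R3 →L[ℝ] R3 := (innerSL ℝ (‖x‖⁻¹ • x)).smulRight e
  have hBx : B x = ‖x‖ • e := by
    simp only [B, ContinuousLinearMap.smulRight_apply, innerSL_apply_apply, real_inner_smul_left,
      real_inner_self_eq_norm_sq]
    congr 1
    by_cases h : ‖x‖ = 0
    · simp [h]
    · field_simp
  have hB : ‖B‖ ≤ 1 := by
    simp only [B, ContinuousLinearMap.norm_smulRight_apply, innerSL_apply_norm, norm_smul, norm_inv,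
      norm_norm]
    have : ‖x‖⁻¹ * ‖x‖ ≤ 1 := inv_mul_le_one
    exact mul_le_one₀ this (norm_nonneg _) he
  have hd : Continuous (fderiv ℝ Q) := hQ.continuous_fderiv (by simp)
  have hd0 := fderiv_eq_zero_off hQ0
  have i : ∀ v, Integrable (fun p => fderiv ℝ Q p v (f (affAct p x))) affMeasure := fun v =>
    integrable_kernel (hd.clm_apply continuous_const)
      (fun p hp => by rw [hd0 p hp]; rfl) hf hx
  have key : ‖x‖ • affOp (fun p => fderiv ℝ Q p (0, e)) f x =
      affOp (fun p => fderiv ℝ Q p (B, 0)) f x := by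
    have h0 := affOp_fderiv_invariant hQ hQ0 hf hx B
    rw [← sub_eq_zero, ← neg_eq_zero, neg_sub, ← h0]
    unfold affOp
    rw [← integral_smul]
    refine (integral_sub (i (B, 0)) ((i (0, e)).smul ‖x‖)).symm.trans ?_
    congr 1
    ext1 p
    have : ((B, -B x) : AffParam) = (B, 0) - ‖x‖ • (0, e) := by
      refine Prod.ext ?_ (by simp [hBx])
      refine ContinuousLinearMap.ext fun y => ?_
      change B y = B y - ‖x‖ • (0 : R3)
      rw [smul_zero, sub_zero]
    simp only [this, map_sub, map_smul]
    rfl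
  rw [key]
  refine enorm_affOp_le (fun p hp => by rw [hd0 p hp]; rfl) (fun p => ?_) f x
  refine ((fderiv ℝ Q p).le_opNorm _).trans ?_
  have : ‖((B, 0) : AffParam)‖ ≤ 1 := by simpa [Prod.norm_def] using hB
  calc _ ≤ C * 1 := mul_le_mul (hC p) this (norm_nonneg _) ((norm_nonneg (fderiv ℝ Q p)).trans (hC p))
    _ = C := mul_one C

lemma affOp_fderiv_sub {Q : AffParam → E →L[ℝ] F} (hQ : ContDiff ℝ 1 Q)
    (hQ0 : ∀ p ∉ paramBall, Q p = 0) {f g : R3 → E} (hf : StronglyMeasurable f)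
    (hg : StronglyMeasurable g) {x : R3} (hfx : affAvg f x < ⊤) (hgx : affAvg g x < ⊤)
    (v : AffParam) : affOp (fun p => fderiv ℝ Q p v) (f - g) x =
      affOp (fun p => fderiv ℝ Q p v) f x - affOp (fun p => fderiv ℝ Q p v) g x :=
  affOp_sub ((hQ.continuous_fderiv (by simp)).clm_apply continuous_const)
    (fun p hp => by rw [fderiv_eq_zero_off hQ0 p hp]; rfl) hf hg hfx hgx

lemma exists_affOp_fderiv_le {Q : AffParam → E →L[ℝ] F} (hQ : ContDiff ℝ 1 Q)
    (hQ0 : ∀ p ∉ paramBall, Q p = 0) : ∃ C : ℝ, 0 ≤ C ∧ ∀ (f : R3 → E) (x : R3) (e : R3),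
      StronglyMeasurable f → affAvg f x < ⊤ → ‖e‖ ≤ 1 →
      ‖affOp (fun p => fderiv ℝ Q p (0, e)) f x‖ₑ ≤ ENNReal.ofReal C * affAvg f x ∧
      ‖‖x‖ • affOp (fun p => fderiv ℝ Q p (0, e)) f x‖ₑ ≤ ENNReal.ofReal C * affAvg f x := by
  have hd0 := fderiv_eq_zero_off hQ0
  obtain ⟨C, hC0, hC⟩ := exists_norm_le_of_eq_zero_off (hQ.continuous_fderiv (by simp)) hd0
  refine ⟨C, hC0, fun f x e hf hx he => ⟨?_, weighted_affOp_le hQ hQ0 hC hf hx he⟩⟩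
  refine enorm_affOp_le (fun p hp => by rw [hd0 p hp]; rfl) (fun p => ?_) f x
  refine ((fderiv ℝ Q p).le_opNorm _).trans ?_
  have : ‖((0, e) : AffParam)‖ ≤ 1 := by simpa [Prod.norm_def] using he
  calc _ ≤ C * 1 := mul_le_mul (hC p) this (norm_nonneg _) hC0
    _ = C := mul_one C

end affOp

/-! ### Averages that preserve solenoidal fields, and their gradients -/

lemma isUnit_one_add {N : R3 →L[ℝ] R3} (hN : ‖N‖ < 1) : IsUnit (1 + N) := by
  have := (Units.oneSub (-N) (by rwa [norm_neg])).isUnit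
  simpa using this

lemma contDiffAt_inverse_one_add {N : R3 →L[ℝ] R3} (hN : ‖N‖ < 1) :
    ContDiffAt ℝ ∞ (fun N : R3 →L[ℝ] R3 => Ring.inverse (1 + N)) N := by
  obtain ⟨v, hv⟩ := isUnit_one_add hN
  have h := contDiffAt_ringInverse ℝ (n := ∞) v
  rw [hv] at h
  exact h.comp N (contDiffAt_const.add contDiffAt_id)

/-- The kernel `w(N, b) (1 + N)⁻¹`. -/
def pullKernel (w : AffParam → ℝ) (p : AffParam) : R3 →L[ℝ] R3 := w p • Ring.inverse (1 + p.1)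

/-- The kernel `G ↦ w(N, b) (1 + N)⁻¹ G (1 + N)`. -/
def conjKernel (w : AffParam → ℝ) (p : AffParam) : (R3 →L[ℝ] R3) →L[ℝ] (R3 →L[ℝ] R3) :=
  (ContinuousLinearMap.compL ℝ R3 R3 R3 (pullKernel w p)).comp
    ((ContinuousLinearMap.compL ℝ R3 R3 R3).flip (1 + p.1))

/-- The kernel `y ↦ eₖᵀ (1 + N) ⊗ w(N, b) (1 + N)⁻¹ y`. -/
def coordKernel (w : AffParam → ℝ) (k : Fin 3) (p : AffParam) : R3 →L[ℝ] (R3 →L[ℝ] R3) :=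
  (ContinuousLinearMap.smulRightL ℝ R3 R3
    ((EuclideanSpace.proj k : R3 →L[ℝ] ℝ).comp (1 + p.1))).comp (pullKernel w p)

lemma conjKernel_apply (w : AffParam → ℝ) (p : AffParam) (G : R3 →L[ℝ] R3) (h : R3) :
    conjKernel w p G h = w p • Ring.inverse (1 + p.1) (G ((1 + p.1) h)) := rfl

lemma coordKernel_apply (w : AffParam → ℝ) (k : Fin 3) (p : AffParam) (y h : R3) :
    coordKernel w k p y h = (h + p.1 h) k • w p • Ring.inverse (1 + p.1) y := rfl

/-- Expanding `(1 + N) h` in the standard basis isolates the partial derivatives `G eₖ`, each of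
which can be integrated by parts in its own direction. -/
lemma conjKernel_eq_sum (w : AffParam → ℝ) (p : AffParam) (G : R3 →L[ℝ] R3) :
    conjKernel w p G = ∑ k, coordKernel w k p (G (EuclideanSpace.single k 1)) := by
  refine ContinuousLinearMap.ext fun h => ?_
  rw [conjKernel_apply, _root_.sum_apply]
  simp only [coordKernel_apply]
  have e : (1 + p.1) h = ∑ k, (h + p.1 h) k • EuclideanSpace.single k (1 : ℝ) := by
    have := (EuclideanSpace.basisFun (Fin 3) ℝ).sum_repr (h + p.1 h)
    simp only [EuclideanSpace.basisFun_repr, EuclideanSpace.basisFun_apply] at this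
    rw [this]
    rfl
  rw [e, map_sum, map_sum, Finset.smul_sum]
  refine Finset.sum_congr rfl fun k _ => ?_
  rw [map_smul, map_smul, smul_comm]

/-- A smooth weight supported in the admissible parameters. -/
structure IsParamWeight (w : AffParam → ℝ) : Prop where
  contDiff : ContDiff ℝ ∞ w
  eq_zero : ∀ p ∉ paramBall, w p = 0

/-- Along `(0, e)` the matrix parameter is constant, so the derivative falls on `w` only; `L` needs
no regularity. -/
lemma fderiv_weight_smul {w : AffParam → ℝ} (hw : ContDiff ℝ ∞ w) {F : Type*} [NormedAddCommGroup F]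
    [NormedSpace ℝ F] {Q : AffParam → F} (hQ : ContDiff ℝ ∞ Q) {L : (R3 →L[ℝ] R3) → F}
    (hQL : ∀ p, Q p = w p • L p.1) (e : R3) (p : AffParam) :
    fderiv ℝ Q p (0, e) = fderiv ℝ w p (0, e) • L p.1 := by
  have h1 : HasLineDerivAt ℝ Q (fderiv ℝ Q p (0, e)) p (0, e) :=
    ((hQ.differentiable (by simp)) p).hasFDerivAt.hasLineDerivAt _
  have h2 : HasLineDerivAt ℝ w (fderiv ℝ w p (0, e)) p (0, e) :=
    ((hw.differentiable (by simp)) p).hasFDerivAt.hasLineDerivAt _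
  have h3 : (fun t : ℝ => Q (p + t • (0, e))) = fun t : ℝ => w (p + t • (0, e)) • L p.1 := by
    ext1 t
    rw [hQL]
    congr 2
    change p.1 + t • (0 : R3 →L[ℝ] R3) = p.1
    refine ContinuousLinearMap.ext fun y => ?_
    change p.1 y + t • (0 : R3) = p.1 y
    rw [smul_zero, add_zero]
  rw [HasLineDerivAt, h3] at h1
  exact h1.unique (HasDerivAt.smul_const h2 _)

/-- The operator `u ↦ -∑ₖ ∫ ∂_{bₖ} Qₖ(p) u(x + N x + b) dp`, where `Qₖ = coordKernel w k`. -/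
def gradOp (w : AffParam → ℝ) (u : R3 → R3) (x : R3) : R3 →L[ℝ] R3 :=
  -∑ k, affOp (fun p => fderiv ℝ (coordKernel w k) p (0, EuclideanSpace.single k 1)) u x

namespace IsParamWeight

variable {w : AffParam → ℝ}

lemma pullKernel_eq_zero (hw : IsParamWeight w) : ∀ p ∉ paramBall, pullKernel w p = 0 := fun p hp => by
  rw [pullKernel, hw.eq_zero p hp]
  exact zero_smul ℝ (Ring.inverse (1 + p.1))

lemma conjKernel_eq_zero (hw : IsParamWeight w) : ∀ p ∉ paramBall, conjKernel w p = 0 := fun p hp => by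
  rw [conjKernel, hw.pullKernel_eq_zero p hp, map_zero, ContinuousLinearMap.zero_comp]

lemma coordKernel_eq_zero (hw : IsParamWeight w) (k : Fin 3) : ∀ p ∉ paramBall, coordKernel w k p = 0 := fun p hp => by
  rw [coordKernel, hw.pullKernel_eq_zero p hp, ContinuousLinearMap.comp_zero]

/-- `Ring.inverse (1 + N)` is smooth only at invertible `1 + N`. This holds on `paramBall`, and on
its open complement the kernel vanishes. -/
lemma contDiff_pullKernel (hw : IsParamWeight w) : ContDiff ℝ ∞ (pullKernel w) := by
  refine contDiff_iff_contDiffAt.2 fun p => ?_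
  by_cases hp : p ∈ paramBall
  · refine hw.contDiff.contDiffAt.smul ?_
    have : ‖p.1‖ < 1 := by
      have := (norm_fst_le p).trans (norm_le_half_of_mem_paramBall hp)
      linarith
    exact (contDiffAt_inverse_one_add this).comp p contDiffAt_fst
  · refine (contDiffAt_const (c := 0)).congr_of_eventuallyEq ?_
    filter_upwards [isCompact_paramBall.isClosed.isOpen_compl.mem_nhds hp] with y hy
    exact hw.pullKernel_eq_zero y hy

lemma contDiff_conjKernel (hw : IsParamWeight w) : ContDiff ℝ ∞ (conjKernel w) := by
  refine ContDiff.clm_comp ?_ ?_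
  · exact (ContinuousLinearMap.contDiff _).comp hw.contDiff_pullKernel
  · exact (ContinuousLinearMap.contDiff _).comp (contDiff_const.add contDiff_fst)

lemma contDiff_coordKernel (hw : IsParamWeight w) (k : Fin 3) : ContDiff ℝ ∞ (coordKernel w k) := by
  refine ContDiff.clm_comp ?_ hw.contDiff_pullKernel
  refine (ContinuousLinearMap.contDiff _).comp ?_
  exact ContDiff.clm_comp contDiff_const (contDiff_const.add contDiff_fst)

/-- Integration by parts in the translation parameter, against a weak gradient. -/
lemma affOp_weakGradient (hw : IsParamWeight w) {F : Type*} [NormedAddCommGroup F] [NormedSpace ℝ F] [CompleteSpace F]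
    {u : R3 → R3} {G : R3 → R3 →L[ℝ] R3} (h : IsWeakGradient u G)
    (hu : StronglyMeasurable u) (hG : StronglyMeasurable G)
    {Q : AffParam → R3 →L[ℝ] F} (hQ : ContDiff ℝ ∞ Q) {L : (R3 →L[ℝ] R3) → R3 →L[ℝ] F}
    (hQL : ∀ p, Q p = w p • L p.1) {x : R3} (hux : affAvg u x < ⊤) {e : R3}
    (hGx : affAvg (fun y => G y e) x < ⊤) :
    affOp Q (fun y => G y e) x = -affOp (fun p => fderiv ℝ Q p (0, e)) u x := by
  have hQ0 : ∀ p ∉ paramBall, Q p = 0 := fun p hp => by rw [hQL, hw.eq_zero p hp, zero_smul]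
  have hGe : StronglyMeasurable fun y => G y e := 
    (ContinuousLinearMap.apply ℝ R3 e).continuous.comp_stronglyMeasurable hG
  have i1 := integrable_kernel hQ.continuous hQ0 hGe hGx
  have i2 := integrable_kernel (K := fun p => fderiv ℝ Q p (0, e))
    ((hQ.continuous_fderiv (by simp)).clm_apply continuous_const)
    (fun p hp => by rw [fderiv_eq_zero_off hQ0 p hp]; rfl) hu hux
  unfold affOp
  rw [affMeasure] at i1 i2 ⊢
  rw [integral_prod _ i1, integral_prod _ i2, ← integral_neg]
  congr 1
  ext1 N
  -- For fixed `N`, the substitution `z = x + N x + b` turns the weight into a scalar test function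
  -- of `z`, while `L N` comes out of the integral; the weak gradient identity applies.
  set θ : R3 → ℝ := fun z => w (N, z - (x + N x)) with hθ
  have hj : ContDiff ℝ ∞ fun z : R3 => ((N, z - (x + N x)) : AffParam) :=
    contDiff_const.prodMk (contDiff_id.sub contDiff_const)
  have hθs : ContDiff ℝ ∞ θ := hw.contDiff.comp hj
  have hθc : HasCompactSupport θ := by
    refine HasCompactSupport.intro (isCompact_closedBall (x + N x) affRadius) fun z hz => ?_
    refine hw.eq_zero _ fun hmem => hz ?_
    have := (norm_snd_le _).trans (norm_le_of_mem_paramBall hmem)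
    rwa [mem_closedBall_iff_norm]
  have hθd : ∀ z, fderiv ℝ θ z e = fderiv ℝ w (N, z - (x + N x)) (0, e) := by
    intro z
    have h1 : HasFDerivAt (fun z : R3 => ((N, z - (x + N x)) : AffParam))
        (ContinuousLinearMap.prod 0 (ContinuousLinearMap.id ℝ R3)) z :=
      (hasFDerivAt_const N z).prodMk ((hasFDerivAt_id z).sub_const _)
    have h2 := ((hw.contDiff.differentiable (by simp)) (N, z - (x + N x))).hasFDerivAt.comp z h1
    have h3 : HasFDerivAt θ _ z := h2
    rw [h3.fderiv]
    rfl
  have hact : ∀ z, affAct (N, z - (x + N x)) x = z := fun z => by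
    simp only [affAct]
    abel
  have j1 := (LocallyIntegrable.apply_vec h.2.1 e).integrable_smul_left_of_hasCompactSupport
    hθs.continuous hθc
  have j2 := h.1.integrable_smul_left_of_hasCompactSupport
    (fderiv_test_continuous hθs e) (fderiv_test_support hθc e)
  have k1 : ∫ b, Q (N, b) (G (affAct (N, b) x) e) = L N (∫ z, θ z • G z e) := by
    rw [← integral_sub_right_eq_self _ (x + N x), ← ContinuousLinearMap.integral_comp_comm _ j1]
    congr 1
    ext1 z
    rw [hact, hQL, map_smul]
    rfl
  have k2 : ∫ b, fderiv ℝ Q (N, b) (0, e) (u (affAct (N, b) x)) =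
      L N (∫ z, fderiv ℝ θ z e • u z) := by
    rw [← integral_sub_right_eq_self _ (x + N x), ← ContinuousLinearMap.integral_comp_comm _ j2]
    congr 1
    ext1 z
    rw [hact, fderiv_weight_smul hw.contDiff hQ hQL, map_smul, hθd]
    rfl
  change ∫ b, Q (N, b) (G (affAct (N, b) x) e) =
    -∫ b, fderiv ℝ Q (N, b) (0, e) (u (affAct (N, b) x))
  rw [k1, k2, h.2.2 θ hθs hθc e, map_neg]

/-- The derivative of the average of `u`, with all derivatives moved to the kernel. -/
lemma affOp_conjKernel_eq (hw : IsParamWeight w) {u : R3 → R3} {G : R3 → R3 →L[ℝ] R3} (h : IsWeakGradient u G)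
    (hu : StronglyMeasurable u) (hG : StronglyMeasurable G) {x : R3} (hux : affAvg u x < ⊤)
    (hGx : affAvg G x < ⊤) : affOp (conjKernel w) G x = gradOp w u x := by
  have hGe : ∀ k : Fin 3, affAvg (fun y => G y (EuclideanSpace.single k 1)) x < ⊤ := by
    intro k
    refine lt_of_le_of_lt (lintegral_mono fun p => ?_) hGx
    have := (G (affAct p x)).le_opNorm (EuclideanSpace.single k 1)
    rw [PiLp.norm_single, norm_one, mul_one] at this
    exact enorm_le_iff_norm_le.2 this
  have hint : ∀ k : Fin 3, Integrable (fun p => coordKernel w k p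
      (G (affAct p x) (EuclideanSpace.single k 1))) affMeasure := fun k =>
    integrable_kernel (f := fun y => G y (EuclideanSpace.single k 1))
      (hw.contDiff_coordKernel k).continuous (hw.coordKernel_eq_zero k)
      ((ContinuousLinearMap.apply ℝ R3 _).continuous.comp_stronglyMeasurable hG) (hGe k)
  unfold affOp gradOp
  simp only [conjKernel_eq_sum]
  rw [integral_finsetSum _ fun k _ => hint k, ← Finset.sum_neg_distrib]
  refine Finset.sum_congr rfl fun k _ => ?_
  refine hw.affOp_weakGradient h hu hG (hw.contDiff_coordKernel k)
    (L := fun N => (ContinuousLinearMap.smulRightL ℝ R3 R3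
      ((EuclideanSpace.proj k : R3 →L[ℝ] ℝ).comp (1 + N))).comp (Ring.inverse (1 + N)))
    (fun p => ?_) hux (hGe k)
  rw [coordKernel, pullKernel]
  exact ContinuousLinearMap.comp_smul _ _ _

lemma exists_gradOp_le (hw : IsParamWeight w) : ∃ C : ℝ, ∀ (f : R3 → R3) (x : R3), StronglyMeasurable f →
    affAvg f x < ⊤ → ‖gradOp w f x‖ₑ ≤ ENNReal.ofReal C * affAvg f x ∧
      ‖‖x‖ • gradOp w f x‖ₑ ≤ ENNReal.ofReal C * affAvg f x := by
  choose C hC0 hC using fun k => exists_affOp_fderiv_le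
    ((hw.contDiff_coordKernel k).of_le (by simp)) (hw.coordKernel_eq_zero k)
  have he : ∀ k : Fin 3, ‖(EuclideanSpace.single k 1 : R3)‖ ≤ 1 := fun k => by simp
  refine ⟨∑ k, C k, fun f x hf hx => ?_⟩
  rw [ENNReal.ofReal_sum_of_nonneg fun k _ => hC0 k, Finset.sum_mul]
  constructor
  · rw [gradOp, enorm_neg]
    exact (enorm_sum_le _ _).trans (Finset.sum_le_sum fun k _ => (hC k f x _ hf hx (he k)).1)
  · rw [gradOp, smul_neg, enorm_neg, Finset.smul_sum]
    exact (enorm_sum_le _ _).trans (Finset.sum_le_sum fun k _ => (hC k f x _ hf hx (he k)).2)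

lemma gradOp_sub (hw : IsParamWeight w) {f g : R3 → R3} (hf : StronglyMeasurable f)
    (hg : StronglyMeasurable g) {x : R3} (hfx : affAvg f x < ⊤) (hgx : affAvg g x < ⊤) :
    gradOp w (f - g) x = gradOp w f x - gradOp w g x := by
  simp only [gradOp]
  rw [neg_sub_neg, ← Finset.sum_sub_distrib, ← Finset.sum_neg_distrib]
  refine Finset.sum_congr rfl fun k _ => ?_
  rw [affOp_fderiv_sub ((hw.contDiff_coordKernel k).of_le (by simp)) (hw.coordKernel_eq_zero k)
    hf hg hfx hgx, neg_sub]

end IsParamWeight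

/-! ### Averages of test fields -/

/-- The divergence of a vector field with derivative `L`. -/
def diagSum : (R3 →L[ℝ] R3) →L[ℝ] ℝ :=
  ∑ i : Fin 3, (EuclideanSpace.proj i : R3 →L[ℝ] ℝ).comp
    (ContinuousLinearMap.apply ℝ R3 (EuclideanSpace.single i 1))

lemma divergence_eq_diagSum (φ : R3 → R3) (x : R3) :
    divergence φ x = diagSum (fderiv ℝ φ x) := by
  simp [divergence, diagSum]

lemma diagSum_eq_trace (L : R3 →L[ℝ] R3) : diagSum L = LinearMap.trace ℝ R3 L := by
  rw [LinearMap.trace_eq_sum_inner _ (EuclideanSpace.basisFun (Fin 3) ℝ)]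
  simp [diagSum, EuclideanSpace.inner_single_left]

/-- The divergence is a trace, and the trace is invariant under conjugation by the invertible `1 +
N`. -/
lemma IsParamWeight.diagSum_conjKernel {w : AffParam → ℝ} (hw : IsParamWeight w) (p : AffParam)
    (G : R3 →L[ℝ] R3) : diagSum (conjKernel w p G) = w p * diagSum G := by
  by_cases hp : p ∈ paramBall
  · have hu : IsUnit (1 + p.1) := isUnit_one_add (by
      have := (norm_fst_le p).trans (norm_le_half_of_mem_paramBall hp)
      linarith)
    have e : conjKernel w p G = w p • (Ring.inverse (1 + p.1) * (G * (1 + p.1))) := rfl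
    rw [e, map_smul, smul_eq_mul, diagSum_eq_trace, diagSum_eq_trace]
    congr 1
    have h1 : ((Ring.inverse (1 + p.1) * (G * (1 + p.1)) : R3 →L[ℝ] R3) : R3 →ₗ[ℝ] R3) =
      (Ring.inverse (1 + p.1) : R3 →L[ℝ] R3).toLinearMap *
        (G * (1 + p.1) : R3 →L[ℝ] R3).toLinearMap := rfl
    rw [h1, LinearMap.trace_mul_comm]
    have h2 : (G * (1 + p.1) : R3 →L[ℝ] R3).toLinearMap *
        (Ring.inverse (1 + p.1) : R3 →L[ℝ] R3).toLinearMap =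
        ((G * (1 + p.1) * Ring.inverse (1 + p.1) : R3 →L[ℝ] R3) : R3 →ₗ[ℝ] R3) := rfl
    rw [h2, mul_assoc, Ring.mul_inverse_cancel _ hu, mul_one]
  · rw [hw.conjKernel_eq_zero p hp, hw.eq_zero p hp]
    simp

lemma contDiff_integral_param {F : Type*} [NormedAddCommGroup F] [NormedSpace ℝ F]
    {f : R3 × AffParam → F} (hf : ContDiff ℝ ∞ f) (hf0 : ∀ x, ∀ p ∉ paramBall, f (x, p) = 0) :
    ContDiff ℝ ∞ (fun x => ∫ p, f (x, p) ∂affMeasure) := by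
  -- The parameter integral is the convolution of the constant `1` with `p ↦ f (x, -p)`, evaluated
  -- at `0`.
  have h := contDiffOn_convolution_right_with_param_comp (μ := affMeasure) (n := ⊤)
    (ContinuousLinearMap.lsmul ℝ ℝ) (f := fun _ : AffParam => (1 : ℝ))
    (g := fun x p => f (x, -p)) (s := Set.univ) (k := paramBall) (v := fun _ => (0 : AffParam))
    contDiffOn_const isOpen_univ isCompact_paramBall ?_ (locallyIntegrable_const _) ?_
  · rw [contDiffOn_univ] at h
    convert h using 2 with x
    simp [convolution]
  · intro x p _ hp
    refine hf0 x _ ?_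
    simpa [paramBall] using hp
  · exact (hf.comp (contDiff_fst.prodMk contDiff_snd.neg)).contDiffOn

/-! ### Test fields: weak gradients, integrability, stability under averaging -/

lemma SolenoidalTest.isWeakGradient {φ : R3 → R3} (h : φ ∈ SolenoidalTest) :
    IsWeakGradient φ (fderiv ℝ φ) := by
  obtain ⟨h1, h2, -⟩ := h
  have hd : Continuous (fderiv ℝ φ) := h1.continuous_fderiv (by simp)
  refine ⟨h1.continuous.locallyIntegrable, hd.locallyIntegrable, fun θ k1 k2 v => ?_⟩
  refine integral_bilinear_fderiv_right_eq_neg_left_of_integrable (μ := (volume : Measure R3))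
    (B := ContinuousLinearMap.lsmul ℝ ℝ) (f := θ) (g := φ) (v := v) ?_ ?_ ?_
    (fun x _ => k1.differentiable (by simp) x) (fun x _ => h1.differentiable (by simp) x)
  · exact ((fderiv_test_continuous k1 v).smul h1.continuous).integrable_of_hasCompactSupport
      (fderiv_test_support k2 v).smul_right
  · exact (k1.continuous.smul (hd.clm_apply continuous_const)).integrable_of_hasCompactSupport
      k2.smul_right
  · exact (k1.continuous.smul h1.continuous).integrable_of_hasCompactSupport k2.smul_right

lemma SolenoidalTest.continuous_fderiv {φ : R3 → R3} (h : φ ∈ SolenoidalTest) :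
    Continuous (fderiv ℝ φ) := h.1.continuous_fderiv (by simp)

lemma SolenoidalTest.memLp {φ : R3 → R3} (h : φ ∈ SolenoidalTest) (q : ℝ≥0∞) :
    MemLp φ q volume := h.1.continuous.memLp_of_hasCompactSupport h.2.1

lemma SolenoidalTest.memLp_fderiv {φ : R3 → R3} (h : φ ∈ SolenoidalTest) (q : ℝ≥0∞) :
    MemLp (fderiv ℝ φ) q volume :=
  (continuous_fderiv h).memLp_of_hasCompactSupport (h.2.1.fderiv ℝ)

lemma memLp_norm_smul {E : Type*} [NormedAddCommGroup E] [NormedSpace ℝ E] {f : R3 → E}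
    (hf : Continuous f) (hfc : HasCompactSupport f) (q : ℝ≥0∞) :
    MemLp (fun x => ‖x‖ • f x) q volume :=
  (continuous_norm.smul hf).memLp_of_hasCompactSupport
    (HasCompactSupport.smul_left (f := fun x : R3 => ‖x‖) hfc)

lemma SolenoidalTest.memLp_weight_fderiv {φ : R3 → R3} (h : φ ∈ SolenoidalTest) (q : ℝ≥0∞) :
    MemLp (fun x => ‖x‖ • fderiv ℝ φ x) q volume :=
  memLp_norm_smul (continuous_fderiv h) (h.2.1.fderiv ℝ) q

lemma hasFDerivAt_affOp {E F : Type*} [NormedAddCommGroup E] [NormedSpace ℝ E]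
    [NormedAddCommGroup F] [NormedSpace ℝ F] {K : AffParam → E →L[ℝ] F} (hK : Continuous K)
    (hK0 : ∀ p ∉ paramBall, K p = 0) {φ : R3 → E} (h1 : ContDiff ℝ 1 φ)
    (h2 : HasCompactSupport φ) (x : R3) :
    HasFDerivAt (affOp K φ)
      (∫ p, (K p).comp ((fderiv ℝ φ (affAct p x)).comp (1 + p.1)) ∂affMeasure) x := by
  have hd : Continuous (fderiv ℝ φ) := h1.continuous_fderiv (by simp)
  obtain ⟨C, hC⟩ := (h2.fderiv ℝ).exists_bound_of_continuous hd
  have hcs : HasCompactSupport K := HasCompactSupport.intro isCompact_paramBall hK0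
  have hF : ∀ y, Continuous fun p => K p (φ (affAct p y)) := fun y =>
    hK.clm_apply (h1.continuous.comp (continuous_affAct_param y))
  have hN : Continuous fun p : AffParam => 1 + p.1 := continuous_const.add continuous_fst
  refine hasFDerivAt_integral_of_dominated_of_fderiv_le (μ := affMeasure) (s := Set.univ)
    (F := fun y p => K p (φ (affAct p y)))
    (F' := fun y p => (K p).comp ((fderiv ℝ φ (affAct p y)).comp (1 + p.1)))
    (bound := fun p => ‖K p‖ * (C * ‖1 + p.1‖)) Filter.univ_mem
    (Filter.Eventually.of_forall fun y => (hF y).aestronglyMeasurable)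
    ((hF x).integrable_of_hasCompactSupport (HasCompactSupport.intro isCompact_paramBall
      fun p hp => by rw [hK0 p hp]; rfl))
    (hK.clm_comp ((hd.comp (continuous_affAct_param x)).clm_comp hN)).aestronglyMeasurable
    (Filter.Eventually.of_forall fun p y _ => ?_)
    ((hK.norm.mul (continuous_const.mul hN.norm)).integrable_of_hasCompactSupport hcs.norm.mul_right)
    (Filter.Eventually.of_forall fun p y _ => ?_)
  · refine ((K p).opNorm_comp_le _).trans (mul_le_mul_of_nonneg_left ?_ (norm_nonneg _))
    exact (ContinuousLinearMap.opNorm_comp_le _ _).trans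
      (mul_le_mul_of_nonneg_right (hC _) (norm_nonneg _))
  · have h3 := (h1.differentiable (by simp) (affAct p y)).hasFDerivAt.comp y
      (hasFDerivAt_affAct p y)
    exact (K p).hasFDerivAt.comp y h3

lemma IsParamWeight.hasFDerivAt_affOp {w : AffParam → ℝ} (hw : IsParamWeight w) {φ : R3 → R3}
    (h : φ ∈ SolenoidalTest) (x : R3) :
    HasFDerivAt (affOp (pullKernel w) φ) (affOp (conjKernel w) (fderiv ℝ φ) x) x :=
  _root_.hasFDerivAt_affOp hw.contDiff_pullKernel.continuous hw.pullKernel_eq_zero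
    (h.1.of_le (by simp)) h.2.1 x

lemma IsParamWeight.affOp_mem_solenoidalTest {w : AffParam → ℝ} (hw : IsParamWeight w)
    {φ : R3 → R3} (h : φ ∈ SolenoidalTest) : affOp (pullKernel w) φ ∈ SolenoidalTest := by
  refine ⟨?_, ?_, fun x => ?_⟩
  · refine contDiff_integral_param
      (f := fun z : R3 × AffParam => pullKernel w z.2 (φ (affAct z.2 z.1))) ?_
      fun x p hp => by simp [hw.pullKernel_eq_zero p hp]
    exact (hw.contDiff_pullKernel.comp contDiff_snd).clm_apply (h.1.comp contDiff_affAct)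
  · obtain ⟨R, hR⟩ := h.2.1.isCompact.isBounded.subset_closedBall (0 : R3)
    refine HasCompactSupport.intro (isCompact_closedBall (0 : R3) (2 * R + 1)) fun x hx => ?_
    rw [mem_closedBall_zero_iff, not_le] at hx
    refine integral_eq_zero_of_ae (Filter.Eventually.of_forall fun p => ?_)
    by_cases hp : p ∈ paramBall
    · have h1 := norm_le_affAct (norm_le_half_of_mem_paramBall hp) x
      have h2 : φ (affAct p x) = 0 := by
        by_contra hne
        have := hR (subset_tsupport φ hne)
        rw [mem_closedBall_zero_iff] at this
        linarith
      simp [h2]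
    · simp [hw.pullKernel_eq_zero p hp]
  · rw [divergence_eq_diagSum, (hw.hasFDerivAt_affOp h x).fderiv, affOp,
      ← ContinuousLinearMap.integral_comp_comm]
    · simp only [hw.diagSum_conjKernel, ← divergence_eq_diagSum, h.2.2, mul_zero, integral_zero]
    · refine Continuous.integrable_of_hasCompactSupport
        (hw.contDiff_conjKernel.continuous.clm_apply
          ((SolenoidalTest.continuous_fderiv h).comp (continuous_affAct_param x))) ?_
      exact HasCompactSupport.intro isCompact_paramBall
        fun p hp => by rw [hw.conjKernel_eq_zero p hp]; rfl

/-! ### Approximation by averages -/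

lemma eLpNorm_le_of_le_affAvg {E F : Type*} [NormedAddCommGroup E] [NormedSpace ℝ E]
    [NormedAddCommGroup F] {q : ℝ≥0∞} (hq : 1 ≤ q) (hq' : q ≠ ⊤) {f : R3 → E}
    (hf : StronglyMeasurable f) {h : R3 → F} {C : ℝ}
    (hC : ∀ᵐ x, ‖h x‖ₑ ≤ ENNReal.ofReal C * affAvg f x) :
    eLpNorm h q volume ≤ ENNReal.ofReal C * (2 * paramMass * eLpNorm f q volume) := by
  refine (eLpNorm_le_nnreal_smul_eLpNorm_of_ae_le_mul' (c := C.toNNReal) (g := affAvg f) ?_ q).trans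
    ?_
  · filter_upwards [hC] with x hx
    simpa [ENNReal.ofReal] using hx
  · rw [ENNReal.smul_def, smul_eq_mul]
    exact mul_le_mul_right (eLpNorm_affAvg_le hq hq' hf) _

/-- Split off `(K p - K 0) (f ∘ affAct p)`, small by continuity of `K` at `0`; what remains is the
continuity of the affine action. -/
lemma eLpNorm_kernel_comp_sub_le {E : Type*} [NormedAddCommGroup E] [NormedSpace ℝ E]
    {q : ℝ≥0∞} (hq : 1 ≤ q) (hq' : q ≠ ⊤) {K : AffParam → E →L[ℝ] E} (hK : Continuous K)
    (hK0 : K 0 = ContinuousLinearMap.id ℝ E) {f : R3 → E} (hf : MemLp f q volume)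
    {ε : ℝ≥0∞} (hε : ε ≠ 0) : ∃ δ > 0, ∀ p : AffParam, ‖p‖ ≤ δ →
      eLpNorm (fun x => K p (f (affAct p x)) - f x) q volume ≤ ε := by
  have hε2 : ε / 2 ≠ 0 := by simp [hε]
  obtain ⟨δ, hδ, h⟩ := eLpNorm_comp_affAct_sub_le hq hq' hf hε2
  obtain ⟨η, hη, hηε⟩ := ENNReal.exists_nnreal_pos_mul_lt
    (ENNReal.mul_ne_top ENNReal.ofNat_ne_top hf.2.ne : 2 * eLpNorm f q volume ≠ ⊤) hε2
  obtain ⟨d, hd, hKd⟩ := Metric.continuous_iff.1 hK 0 η (by exact_mod_cast hη)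
  refine ⟨min δ (min affRadius (d / 2)), lt_min hδ (lt_min affRadius_pos (by positivity)),
    fun p hp => ?_⟩
  have hp1 : ‖p‖ ≤ affRadius := hp.trans ((min_le_right _ _).trans (min_le_left _ _))
  have hp2 : ‖p‖ < d := by
    have := hp.trans ((min_le_right _ _).trans (min_le_right _ _))
    linarith
  have hKp : ‖K p - K 0‖ ≤ η := by
    have := (hKd p (by rwa [dist_zero_right])).le
    rwa [dist_eq_norm] at this
  have hm : AEStronglyMeasurable (fun x => f (affAct p x)) volume :=
    hf.1.comp_quasiMeasurePreserving (quasiMeasurePreserving_affAct hp1)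
  have e : (fun x => K p (f (affAct p x)) - f x) =
      (fun x => (K p - K 0) (f (affAct p x))) + fun x => f (affAct p x) - f x := by
    ext1 x
    simp [hK0]
  rw [e]
  refine (eLpNorm_add_le ((K p - K 0).continuous.comp_aestronglyMeasurable hm) (hm.sub hf.1)
    hq).trans ?_
  have h1 : eLpNorm (fun x => (K p - K 0) (f (affAct p x))) q volume ≤ ε / 2 := by
    refine (eLpNorm_le_nnreal_smul_eLpNorm_of_ae_le_mul (c := η) (g := fun x => f (affAct p x))
      (Filter.Eventually.of_forall fun x => ?_) q).trans ?_
    · exact (K p - K 0).le_of_opNorm_le hKp _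
    · rw [ENNReal.smul_def, smul_eq_mul]
      exact (mul_le_mul_right (eLpNorm_comp_affAct_le hp1 hq hf.1) _).trans hηε.le
  calc _ ≤ ε / 2 + ε / 2 := add_le_add h1 (h p (hp.trans (min_le_left _ _)))
    _ = ε := ENNReal.add_halves ε

/-- Replacing `‖x‖` by `‖affAct p x‖` reduces to the unweighted estimate for `‖x‖ • f x`. The error
is `O(‖p‖)` times `1 + ‖affAct p x‖`, hence controlled by `f` and its weighted version. -/
lemma eLpNorm_weight_kernel_comp_sub_le {E : Type*} [NormedAddCommGroup E] [NormedSpace ℝ E]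
    {q : ℝ≥0∞} (hq : 1 ≤ q) (hq' : q ≠ ⊤) {K : AffParam → E →L[ℝ] E} (hK : Continuous K)
    (hK0 : K 0 = ContinuousLinearMap.id ℝ E) {f : R3 → E} (hf : MemLp f q volume)
    (hfw : MemLp (fun x => ‖x‖ • f x) q volume) {ε : ℝ≥0∞} (hε : ε ≠ 0) :
    ∃ δ > 0, ∀ p : AffParam, ‖p‖ ≤ δ →
      eLpNorm (fun x => ‖x‖ • (K p (f (affAct p x)) - f x)) q volume ≤ ε := by
  have hε2 : ε / 2 ≠ 0 := by simp [hε]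
  obtain ⟨δ, hδ, h⟩ := eLpNorm_kernel_comp_sub_le hq hq' hK hK0 hfw hε2
  set g : R3 → E := fun x => ‖x‖ • f x with hg
  set s : R3 → ℝ := fun x => 2 * (‖g x‖ + ‖f x‖) with hs
  have hsq : MemLp s q volume := (hfw.norm.add hf.norm).const_mul 2
  obtain ⟨η, hη, hηε⟩ := ENNReal.exists_nnreal_pos_mul_lt
    (ENNReal.mul_ne_top ENNReal.ofNat_ne_top hsq.2.ne : 2 * eLpNorm s q volume ≠ ⊤) hε2
  obtain ⟨d, hd, hKd⟩ := Metric.continuous_iff.1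
    (show Continuous fun p : AffParam => ‖p‖ * ‖K p‖ from continuous_norm.mul hK.norm) 0 η (by exact_mod_cast hη)
  refine ⟨min δ (min affRadius (d / 2)), lt_min hδ (lt_min affRadius_pos (by positivity)),
    fun p hp => ?_⟩
  have hp1 : ‖p‖ ≤ affRadius := hp.trans ((min_le_right _ _).trans (min_le_left _ _))
  have hp2 : ‖p‖ < d := by
    have := hp.trans ((min_le_right _ _).trans (min_le_right _ _))
    linarith
  have hKp : ‖p‖ * ‖K p‖ ≤ η := by
    have := (hKd p (by rwa [dist_zero_right])).le
    rw [norm_zero, zero_mul, dist_zero_right] at this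
    exact (le_abs_self _).trans this
  have hqm := quasiMeasurePreserving_affAct hp1
  have hm : AEStronglyMeasurable (fun x => f (affAct p x)) volume :=
    hf.1.comp_quasiMeasurePreserving hqm
  have hgm : AEStronglyMeasurable (fun x => g (affAct p x)) volume :=
    hfw.1.comp_quasiMeasurePreserving hqm
  have e : (fun x => ‖x‖ • (K p (f (affAct p x)) - f x)) =
      (fun x => (‖x‖ - ‖affAct p x‖) • K p (f (affAct p x))) +
        fun x => K p (g (affAct p x)) - g x := by
    ext1 x
    simp only [hg, Pi.add_apply, map_smul, sub_smul, smul_sub]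
    abel
  rw [e]
  have hcn : Continuous fun x => ‖x‖ - ‖affAct p x‖ :=
    continuous_norm.sub (continuous_affAct_left p).norm
  refine (eLpNorm_add_le (hcn.aestronglyMeasurable.smul
    ((K p).continuous.comp_aestronglyMeasurable hm))
    (((K p).continuous.comp_aestronglyMeasurable hgm).sub hfw.1) hq).trans ?_
  have h1 : eLpNorm (fun x => (‖x‖ - ‖affAct p x‖) • K p (f (affAct p x))) q volume ≤ ε / 2 := by
    refine (eLpNorm_le_nnreal_smul_eLpNorm_of_ae_le_mul (c := η) (g := fun x => s (affAct p x))
      (Filter.Eventually.of_forall fun x => ?_) q).trans ?_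
    · have h2 : |‖x‖ - ‖affAct p x‖| ≤ ‖p‖ * (2 * (‖affAct p x‖ + 1)) := by
        rw [abs_sub_comm]
        refine (abs_norm_sub_norm_le _ _).trans ((norm_affAct_sub_le p x).trans ?_)
        gcongr
        have := norm_le_affAct (hp1.trans affRadius_le) x
        linarith
      change ‖(‖x‖ - ‖affAct p x‖) • K p (f (affAct p x))‖ ≤ η * ‖s (affAct p x)‖
      rw [norm_smul, Real.norm_eq_abs]
      calc |‖x‖ - ‖affAct p x‖| * ‖K p (f (affAct p x))‖
          ≤ (‖p‖ * (2 * (‖affAct p x‖ + 1))) * (‖K p‖ * ‖f (affAct p x)‖) :=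
            mul_le_mul h2 ((K p).le_opNorm _) (norm_nonneg _) (by positivity)
        _ = (‖p‖ * ‖K p‖) * s (affAct p x) := by
            simp only [hs, hg, norm_smul, norm_norm]
            ring
        _ ≤ η * s (affAct p x) := by
            gcongr
        _ ≤ η * ‖s (affAct p x)‖ := by
            gcongr
            exact le_abs_self _
    · rw [ENNReal.smul_def, smul_eq_mul]
      exact (mul_le_mul_right (eLpNorm_comp_affAct_le hp1 hq hsq.1) _).trans hηε.le
  calc _ ≤ ε / 2 + ε / 2 := add_le_add h1 (h p (hp.trans (min_le_left _ _)))
    _ = ε := ENNReal.add_halves ε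

/-- As `w` has integral one, the difference is a `w`-average of the differences for single
parameters, and averaging does not increase `L^q` norms. -/
lemma IsParamWeight.eLpNorm_affOp_sub_le {E : Type*} [NormedAddCommGroup E] [NormedSpace ℝ E]
    [CompleteSpace E] {q : ℝ≥0∞} (hq : 1 ≤ q) (hq' : q ≠ ⊤) {w : AffParam → ℝ}
    (hw : IsParamWeight w) (hw0 : ∀ p, 0 ≤ w p) (hw1 : ∫ p, w p ∂affMeasure = 1)
    {K : AffParam → E →L[ℝ] E} (hK : Continuous K) {f : R3 → E} (hf : StronglyMeasurable f)
    (hfq : MemLp f q volume) {ρ : R3 → ℝ} (hρ : Continuous ρ) {ε : ℝ≥0∞}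
    (h : ∀ p, w p ≠ 0 → eLpNorm (fun x => ρ x • (K p (f (affAct p x)) - f x)) q volume ≤ ε) :
    eLpNorm (fun x => ρ x • (affOp (fun p => w p • K p) f x - f x)) q volume ≤ ε := by
  have hwc : Continuous w := hw.contDiff.continuous
  have hwi : Integrable w affMeasure := hwc.integrable_of_hasCompactSupport
    (HasCompactSupport.intro isCompact_paramBall hw.eq_zero)
  have hwm : Measurable fun p => ENNReal.ofReal (w p) := hwc.measurable.ennreal_ofReal
  set ν : Measure AffParam := affMeasure.withDensity fun p => ENNReal.ofReal (w p)
  have hν : IsProbabilityMeasure ν := by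
    refine ⟨?_⟩
    rw [withDensity_apply _ MeasurableSet.univ, setLIntegral_univ,
      ← ofReal_integral_eq_lintegral_ofReal hwi (Filter.Eventually.of_forall hw0), hw1,
      ENNReal.ofReal_one]
  set g : R3 × AffParam → ℝ≥0∞ := fun z => ‖ρ z.1 • (K z.2 (f (affAct z.2 z.1)) - f z.1)‖ₑ
  have hg : Measurable g := by
    refine StronglyMeasurable.enorm ?_
    refine (hρ.comp continuous_fst).stronglyMeasurable.smul (StronglyMeasurable.sub ?_
      (hf.comp_measurable measurable_fst))
    exact isBoundedBilinearMap_apply.continuous.comp_stronglyMeasurable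
      ((hK.stronglyMeasurable.comp_measurable measurable_snd).prodMk
        (hf.comp_measurable continuous_affAct.measurable))
  have key : eLpNorm (fun x => ∫⁻ p, g (x, p) ∂ν) q volume ≤ ε := by
    refine eLpNorm_lintegral_le volume ν hq hq' hg ?_
    rw [ae_withDensity_iff hwm]
    refine Filter.Eventually.of_forall fun p hp => ?_
    have h1 : w p ≠ 0 := fun h0 => hp (by simp [h0])
    simp only [g]
    rw [eLpNorm_enorm]
    exact h p h1
  refine (eLpNorm_mono_enorm_ae ?_).trans key
  filter_upwards [ae_affAvg_lt_top hq hq' hf hfq] with x hx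
  have hi : Integrable (fun p => (w p • K p) (f (affAct p x))) affMeasure :=
    integrable_kernel (K := fun p => w p • K p) (hwc.smul hK)
      (fun p hp => by simp only [hw.eq_zero p hp, zero_smul]) hf hx
  have e : ρ x • (affOp (fun p => w p • K p) f x - f x) =
      ∫ p, w p • ρ x • (K p (f (affAct p x)) - f x) ∂affMeasure := by
    have h2 : f x = ∫ p, w p • f x ∂affMeasure := by
      rw [integral_smul_const, hw1, one_smul]
    have h3 : affOp (fun p => w p • K p) f x - f x =
        ∫ p, ((w p • K p) (f (affAct p x)) - w p • f x) ∂affMeasure := by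
      rw [integral_sub hi (hwi.smul_const _), ← h2]
      rfl
    rw [h3, ← integral_smul]
    congr 1
    ext1 p
    rw [smul_comm (w p), smul_sub (w p)]
    rfl
  rw [e, enorm_eq_self]
  refine (enorm_integral_le_lintegral_enorm _).trans (le_of_eq ?_)
  rw [lintegral_withDensity_eq_lintegral_mul _ hwm
    (show Measurable fun p => g (x, p) from hg.comp measurable_prodMk_left)]
  congr 1
  ext1 p
  rw [enorm_smul, Real.enorm_eq_ofReal (hw0 p)]
  rfl

/-! ### Density -/

/-- A smooth cutoff on the parameter space, equal to one near the origin. -/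
def paramBump : ContDiffBump (0 : AffParam) :=
  ⟨affRadius / 2, affRadius, half_pos affRadius_pos, half_lt_self affRadius_pos⟩

lemma isParamWeight_paramBump : IsParamWeight paramBump where
  contDiff := paramBump.contDiff
  eq_zero p hp := by
    refine paramBump.zero_of_le_dist ?_
    rw [paramBall, Metric.mem_closedBall, not_le] at hp
    exact hp.le

lemma paramBump_eq_one {p : AffParam} (hp : ‖p‖ ≤ affRadius / 2) : paramBump p = 1 :=
  paramBump.one_of_mem_closedBall (mem_closedBall_zero_iff.2 hp)

lemma pullKernel_paramBump_zero :
    pullKernel paramBump 0 = ContinuousLinearMap.id ℝ R3 := by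
  refine ContinuousLinearMap.ext fun y => ?_
  change paramBump 0 • Ring.inverse (1 + (0 : R3 →L[ℝ] R3)) y = y
  rw [paramBump_eq_one (by simpa using (half_pos affRadius_pos).le), add_zero, Ring.inverse_one, one_smul]
  rfl

lemma conjKernel_paramBump_zero :
    conjKernel paramBump 0 = ContinuousLinearMap.id ℝ (R3 →L[ℝ] R3) := by
  refine ContinuousLinearMap.ext fun G => ContinuousLinearMap.ext fun y => ?_
  change pullKernel paramBump 0 (G ((1 + (0 : R3 →L[ℝ] R3)) y)) = G y
  rw [pullKernel_paramBump_zero, add_zero]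
  rfl

/-- Weights concentrated near the origin give averages close to the identity. -/
lemma exists_paramWeight {q : ℝ≥0∞} (hq : 1 ≤ q) (hq' : q ≠ ⊤) {u : R3 → R3}
    {G : R3 → R3 →L[ℝ] R3} (hu : StronglyMeasurable u) (hG : StronglyMeasurable G)
    (huq : MemLp u q volume) (hGq : MemLp G q volume)
    (hGw : MemLp (fun x => ‖x‖ • G x) q volume) {ε : ℝ≥0∞} (hε : ε ≠ 0) :
    ∃ w, IsParamWeight w ∧
      eLpNorm (fun x => affOp (pullKernel w) u x - u x) q volume ≤ ε ∧
      eLpNorm (fun x => affOp (conjKernel w) G x - G x) q volume ≤ ε ∧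
      eLpNorm (fun x => ‖x‖ • (affOp (conjKernel w) G x - G x)) q volume ≤ ε := by
  -- The estimates need a globally continuous kernel, which `Ring.inverse (1 + N)` is not. The fixed
  -- cutoff supplies one, and equals `1` wherever the concentrated weight lives.
  have hP := isParamWeight_paramBump.contDiff_pullKernel.continuous
  have hC := isParamWeight_paramBump.contDiff_conjKernel.continuous
  obtain ⟨δ₁, h₁, k₁⟩ :=
    eLpNorm_kernel_comp_sub_le hq hq' hP pullKernel_paramBump_zero huq hε
  obtain ⟨δ₂, h₂, k₂⟩ :=
    eLpNorm_kernel_comp_sub_le hq hq' hC conjKernel_paramBump_zero hGq hε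
  obtain ⟨δ₃, h₃, k₃⟩ :=
    eLpNorm_weight_kernel_comp_sub_le hq hq' hC conjKernel_paramBump_zero hGq hGw hε
  set δ : ℝ := min (affRadius / 2) (min δ₁ (min δ₂ δ₃))
  have hδ : 0 < δ := lt_min (half_pos affRadius_pos) (lt_min h₁ (lt_min h₂ h₃))
  have hδ0 : δ ≤ affRadius / 2 := min_le_left _ _
  have hδ1 : δ ≤ δ₁ := (min_le_right _ _).trans (min_le_left _ _)
  have hδ2 : δ ≤ δ₂ := (min_le_right _ _).trans ((min_le_right _ _).trans (min_le_left _ _))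
  have hδ3 : δ ≤ δ₃ := (min_le_right _ _).trans ((min_le_right _ _).trans (min_le_right _ _))
  let b : ContDiffBump (0 : AffParam) := ⟨δ / 2, δ, half_pos hδ, half_lt_self hδ⟩
  set w : AffParam → ℝ := b.normed affMeasure
  have hws : ∀ p, w p ≠ 0 → ‖p‖ ≤ δ := by
    intro p hp
    have h1 : p ∈ Function.support w := hp
    rw [b.support_normed_eq] at h1
    exact (mem_ball_zero_iff.1 h1).le
  have hw : IsParamWeight w := by
    refine ⟨b.contDiff_normed, fun p hp => ?_⟩
    by_contra h
    refine hp (mem_closedBall_zero_iff.2 ?_)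
    linarith [hws p h, affRadius_pos]
  have hw0 : ∀ p, 0 ≤ w p := fun p => b.nonneg_normed p
  have hw1 : ∫ p, w p ∂affMeasure = 1 := b.integral_normed
  have e1 : pullKernel w = fun p => w p • pullKernel paramBump p := by
    ext1 p
    refine ContinuousLinearMap.ext fun y => ?_
    change w p • Ring.inverse (1 + p.1) y = w p • paramBump p • Ring.inverse (1 + p.1) y
    by_cases hp : w p = 0
    · rw [hp, zero_smul, zero_smul]
    · rw [paramBump_eq_one ((hws p hp).trans hδ0), one_smul]
  have e2 : conjKernel w = fun p => w p • conjKernel paramBump p := by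
    ext1 p
    refine ContinuousLinearMap.ext fun G => ContinuousLinearMap.ext fun y => ?_
    change pullKernel w p (G ((1 + p.1) y)) = w p • pullKernel paramBump p (G ((1 + p.1) y))
    rw [e1]
    rfl
  refine ⟨w, hw, ?_, ?_, ?_⟩
  · have h := hw.eLpNorm_affOp_sub_le hq hq' hw0 hw1 hP hu huq
      (ρ := fun _ => 1) continuous_const (ε := ε)
      fun p hp => by simpa only [one_smul] using k₁ p ((hws p hp).trans hδ1)
    rw [e1]
    simpa only [one_smul] using h
  · have h := hw.eLpNorm_affOp_sub_le hq hq' hw0 hw1 hC hG hGq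
      (ρ := fun _ => 1) continuous_const (ε := ε)
      fun p hp => by simpa only [one_smul] using k₂ p ((hws p hp).trans hδ2)
    rw [e2]
    simpa only [one_smul] using h
  · rw [e2]
    exact hw.eLpNorm_affOp_sub_le hq hq' hw0 hw1 hC hG hGq continuous_norm
      fun p hp => k₃ p ((hws p hp).trans hδ3)

/-- Solenoidal test fields approximate in the norm of `Z_q`, if they do so in `L^q`. -/
lemma exists_solenoidalTest_approx {q : ℝ≥0∞} (hq : 1 ≤ q) (hq' : q ≠ ⊤) {u : R3 → R3}
    {G : R3 → R3 →L[ℝ] R3} (hu : StronglyMeasurable u) (hG : StronglyMeasurable G)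
    (huq : MemLp u q volume) (hGq : MemLp G q volume)
    (hGw : MemLp (fun x => ‖x‖ • G x) q volume) (h : IsWeakGradient u G)
    (happrox : ∀ η : ℝ≥0∞, η ≠ 0 → ∃ φ ∈ SolenoidalTest, eLpNorm (φ - u) q volume ≤ η)
    {ε : ℝ≥0∞} (hε : ε ≠ 0) : ∃ ψ ∈ SolenoidalTest,
      eLpNorm (fun x => ψ x - u x) q volume ≤ ε ∧
      eLpNorm (fun x => fderiv ℝ ψ x - G x) q volume ≤ ε ∧
      eLpNorm (fun x => ‖x‖ • (fderiv ℝ ψ x - G x)) q volume ≤ ε := by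
  have hε2 : ε / 2 ≠ 0 := by simp [hε]
  obtain ⟨w, hw, hw1, hw2, hw3⟩ := exists_paramWeight hq hq' hu hG huq hGq hGw hε2
  have hP := hw.contDiff_pullKernel.continuous
  obtain ⟨C₁, -, hC₁⟩ := exists_norm_le_of_eq_zero_off hP hw.pullKernel_eq_zero
  obtain ⟨C₂, hC₂⟩ := hw.exists_gradOp_le
  set C : ℝ := max C₁ C₂
  -- The bound `C` depends on `w`, possibly growing as `w` concentrates; so `w` is fixed first and
  -- the `L^q` tolerance for `φ` is chosen afterwards.
  obtain ⟨η, hη, hηε⟩ := ENNReal.exists_nnreal_pos_mul_lt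
    (ENNReal.mul_ne_top ENNReal.ofReal_ne_top
      (ENNReal.mul_ne_top ENNReal.ofNat_ne_top paramMass_ne_top) :
      ENNReal.ofReal C * (2 * paramMass) ≠ ⊤) hε2
  obtain ⟨φ, hφ, hφu⟩ := happrox η (by exact_mod_cast hη.ne')
  have hφc : Continuous φ := hφ.1.continuous
  have hdc := SolenoidalTest.continuous_fderiv hφ
  have hφq := SolenoidalTest.memLp hφ q
  have hφm : StronglyMeasurable φ := hφc.stronglyMeasurable
  have hdm : StronglyMeasurable (fderiv ℝ φ) := hdc.stronglyMeasurable
  have hm : StronglyMeasurable (φ - u) := hφm.sub hu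
  have bound : ∀ {F : Type} [NormedAddCommGroup F] {v : R3 → F},
      (∀ᵐ x, ‖v x‖ₑ ≤ ENNReal.ofReal C * affAvg (φ - u) x) → eLpNorm v q volume ≤ ε / 2 := by
    intro F _ v hv
    refine (eLpNorm_le_of_le_affAvg hq hq' hm hv).trans (le_trans ?_ hηε.le)
    calc ENNReal.ofReal C * (2 * paramMass * eLpNorm (φ - u) q volume)
        ≤ ENNReal.ofReal C * (2 * paramMass * η) := by gcongr
      _ = η * (ENNReal.ofReal C * (2 * paramMass)) := by ring
  have hau := ae_affAvg_lt_top hq hq' hu huq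
  have haφ := ae_affAvg_lt_top hq hq' hφm hφq
  have ha := ae_affAvg_lt_top hq hq' hm (hφq.sub huq)
  have haG := ae_affAvg_lt_top hq hq' hG hGq
  have had := ae_affAvg_lt_top hq hq' hdm (SolenoidalTest.memLp_fderiv hφ q)
  have b1 : eLpNorm (affOp (pullKernel w) (φ - u)) q volume ≤ ε / 2 := by
    refine bound (Filter.Eventually.of_forall fun x => ?_)
    exact enorm_affOp_le hw.pullKernel_eq_zero (fun p => (hC₁ p).trans (le_max_left _ _)) _ _
  have hC : ∀ x, ENNReal.ofReal C₂ * affAvg (φ - u) x ≤ ENNReal.ofReal C * affAvg (φ - u) x :=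
    fun x => by
      gcongr
      exact le_max_right _ _
  have b2 : eLpNorm (gradOp w (φ - u)) q volume ≤ ε / 2 := by
    refine bound ?_
    filter_upwards [ha] with x hx
    exact (hC₂ _ x hm hx).1.trans (hC x)
  have b3 : eLpNorm (fun x => ‖x‖ • gradOp w (φ - u) x) q volume ≤ ε / 2 := by
    refine bound ?_
    filter_upwards [ha] with x hx
    exact (hC₂ _ x hm hx).2.trans (hC x)
  -- Integration by parts applies to `φ` and to `u`, so the difference of the averaged gradients is
  -- `gradOp w (φ - u)`, which involves no derivative of `φ - u`.
  have hgrad : ∀ᵐ x, fderiv ℝ (affOp (pullKernel w) φ) x - G x =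
      gradOp w (φ - u) x + (affOp (conjKernel w) G x - G x) := by
    filter_upwards [hau, haφ, haG, had] with x h1 h2 h3 h4
    rw [(hw.hasFDerivAt_affOp hφ x).fderiv, hw.gradOp_sub hφm hu h2 h1,
      hw.affOp_conjKernel_eq (SolenoidalTest.isWeakGradient hφ) hφm hdm h2 h4,
      hw.affOp_conjKernel_eq h hu hG h1 h3]
    abel
  have hCm : StronglyMeasurable (affOp (conjKernel w) G) :=
    stronglyMeasurable_affOp hw.contDiff_conjKernel.continuous hG
  -- Measurability is read off from `hgrad`, where the other terms are measurable.
  have hgm : AEStronglyMeasurable (gradOp w (φ - u)) volume := by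
    have h1 : StronglyMeasurable fun x => fderiv ℝ (affOp (pullKernel w) φ) x - G x :=
      (SolenoidalTest.continuous_fderiv (hw.affOp_mem_solenoidalTest hφ)).stronglyMeasurable.sub hG
    refine (h1.sub (hCm.sub hG)).aestronglyMeasurable.congr ?_
    filter_upwards [hgrad] with x hx
    simp only [Pi.sub_apply]
    rw [hx]
    abel
  have hnm : AEStronglyMeasurable (fun x : R3 => ‖x‖) volume := continuous_norm.aestronglyMeasurable
  have hCG : AEStronglyMeasurable (fun x => affOp (conjKernel w) G x - G x) volume :=
    (hCm.sub hG).aestronglyMeasurable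
  refine ⟨affOp (pullKernel w) φ, hw.affOp_mem_solenoidalTest hφ, ?_, ?_, ?_⟩
  · have e : (fun x => affOp (pullKernel w) φ x - u x) =ᵐ[volume]
        affOp (pullKernel w) (φ - u) + fun x => affOp (pullKernel w) u x - u x := by
      filter_upwards [hau, haφ] with x h1 h2
      rw [Pi.add_apply, affOp_sub hP hw.pullKernel_eq_zero hφm hu h2 h1]
      abel
    rw [eLpNorm_congr_ae e]
    refine (eLpNorm_add_le (stronglyMeasurable_affOp hP hm).aestronglyMeasurable
      ((stronglyMeasurable_affOp hP hu).sub hu).aestronglyMeasurable hq).trans ?_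
    exact (add_le_add b1 hw1).trans_eq (ENNReal.add_halves ε)
  · rw [eLpNorm_congr_ae hgrad]
    exact (eLpNorm_add_le hgm hCG hq).trans ((add_le_add b2 hw2).trans_eq (ENNReal.add_halves ε))
  · have e : (fun x => ‖x‖ • (fderiv ℝ (affOp (pullKernel w) φ) x - G x)) =ᵐ[volume]
        (fun x => ‖x‖ • gradOp w (φ - u) x) +
          fun x => ‖x‖ • (affOp (conjKernel w) G x - G x) := by
      filter_upwards [hgrad] with x hx
      rw [hx, Pi.add_apply, smul_add]
    rw [eLpNorm_congr_ae e]
    exact (eLpNorm_add_le (hnm.smul hgm) (hnm.smul hCG) hq).trans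
      ((add_le_add b3 hw3).trans_eq (ENNReal.add_halves ε))

/-! ### Transfer to the normed space `Zq` -/

lemma SolenoidalTest.exists_Zq {q : ℝ≥0∞} [Fact (1 ≤ q)] {φ : R3 → R3} (h : φ ∈ SolenoidalTest) :
    ∃ u : Zq q, Zq.toLq u =ᵐ[volume] φ := by
  have e1 := (SolenoidalTest.memLp h q).coeFn_toLp
  have e2 := (SolenoidalTest.memLp_fderiv h q).coeFn_toLp
  refine ⟨⟨(SolenoidalTest.memLp h q).toLp φ, ?_, (SolenoidalTest.memLp_fderiv h q).toLp _,
    (SolenoidalTest.isWeakGradient h).congr e1.symm e2.symm, ?_⟩, e1⟩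
  · exact (solenoidalTestLp q).le_topologicalClosure ⟨φ, h, e1⟩
  · refine (SolenoidalTest.memLp_weight_fderiv h q).ae_eq ?_
    filter_upwards [e2] with x hx
    rw [hx]

lemma LqSigma.exists_solenoidalTest {q : ℝ≥0∞} [Fact (1 ≤ q)] {u : Lp R3 q (volume : Measure R3)}
    (hu : u ∈ LqSigma q) {η : ℝ≥0∞} (hη : η ≠ 0) :
    ∃ φ ∈ SolenoidalTest, eLpNorm (φ - (u : R3 → R3)) q volume ≤ η := by
  obtain ⟨v, ⟨φ, hφ, hvφ⟩, hv⟩ := EMetric.mem_closure_iff.1 hu η (pos_iff_ne_zero.2 hη)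
  refine ⟨φ, hφ, ?_⟩
  rw [edist_comm, Lp.edist_def] at hv
  rw [← eLpNorm_congr_ae (hvφ.sub (ae_eq_refl _))]
  exact hv.le

lemma Lp.norm_sub_le_of_eLpNorm {E : Type*} [NormedAddCommGroup E] {q : ℝ≥0∞}
    {f g : Lp E q (volume : Measure R3)} {h : R3 → E} (he : (fun x => f x - g x) =ᵐ[volume] h)
    {ε : ℝ} (hε : 0 ≤ ε) (hle : eLpNorm h q volume ≤ ENNReal.ofReal ε) : ‖f - g‖ ≤ ε := by
  rw [Lp.norm_def]
  refine ENNReal.toReal_le_of_le_ofReal hε ?_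
  rwa [eLpNorm_congr_ae ((Lp.coeFn_sub f g).trans he)]

lemma Zq.grad_sub {q : ℝ≥0∞} [Fact (1 ≤ q)] (v u : Zq q) :
    Zq.grad (v - u) = Zq.grad v - Zq.grad u := by
  rw [eq_sub_iff_add_eq, ← Zq.grad_add, sub_add_cancel]

lemma Zq.wgrad_sub {q : ℝ≥0∞} [Fact (1 ≤ q)] (v u : Zq q) :
    Zq.wgrad (v - u) = Zq.wgrad v - Zq.wgrad u := by
  rw [eq_sub_iff_add_eq, ← Zq.wgrad_add, sub_add_cancel]

end

/-- For `1 < q < ∞`, every smooth compactly supported solenoidal vector field on `ℝ³` belongs to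
`Z_q`, and these vector fields form a dense subset of `Z_q` for the norm of `Z_q`. -/
theorem lemma4p2 (q : ℝ≥0∞) [Fact (1 ≤ q)] (hq : 1 < q) (hq' : q < ⊤) :
    (∀ φ ∈ SolenoidalTest, ∃ u : Zq q, Zq.toLq u =ᵐ[volume] φ) ∧
      Dense {u : Zq q | ∃ φ ∈ SolenoidalTest, Zq.toLq u =ᵐ[volume] φ} := by
  refine ⟨fun φ h => SolenoidalTest.exists_Zq h, Metric.dense_iff.2 fun u r hr => ?_⟩
  -- The norm of `Z_q` has three terms, and `3 * (r / 4) < r`.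
  have hr4 : 0 < r / 4 := by positivity
  obtain ⟨ψ, hψ, h1, h2, h3⟩ := exists_solenoidalTest_approx hq.le hq'.ne
    (Lp.stronglyMeasurable (Zq.toLq u)) (Lp.stronglyMeasurable (Zq.grad u)) (Lp.memLp _)
    (Lp.memLp _) (Zq.memLp_weight_grad u) (Zq.isWeakGradient_grad u)
    (fun η hη => LqSigma.exists_solenoidalTest u.2.1 hη)
    (ENNReal.ofReal_pos.2 hr4).ne'
  obtain ⟨v, hv⟩ := SolenoidalTest.exists_Zq (q := q) hψ
  -- `Zq.grad` is a chosen weak gradient; uniqueness identifies it with the classical derivative.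
  have hg : Zq.grad v =ᵐ[volume] fderiv ℝ ψ :=
    ((Zq.isWeakGradient_grad v).congr hv (ae_eq_refl _)).unique (SolenoidalTest.isWeakGradient hψ)
  refine ⟨v, ?_, ψ, hψ, hv⟩
  rw [mem_ball_iff_norm, Zq.norm_def, map_sub, Zq.grad_sub, Zq.wgrad_sub]
  have k1 : ‖Zq.toLq v - Zq.toLq u‖ ≤ r / 4 :=
    Lp.norm_sub_le_of_eLpNorm (by filter_upwards [hv] with x hx; rw [hx]) hr4.le h1
  have k2 : ‖Zq.grad v - Zq.grad u‖ ≤ r / 4 :=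
    Lp.norm_sub_le_of_eLpNorm (by filter_upwards [hg] with x hx; rw [hx]) hr4.le h2
  have k3 : ‖Zq.wgrad v - Zq.wgrad u‖ ≤ r / 4 := by
    refine Lp.norm_sub_le_of_eLpNorm ?_ hr4.le h3
    filter_upwards [hg, Zq.coeFn_wgrad v, Zq.coeFn_wgrad u] with x h4 h5 h6
    rw [h5, h6, h4, smul_sub]
  linarith
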